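/- Let $M$ be a compact connected Riemannian manifold (without boundary) with distance $d$, let $k\ge 1$, and write $S^1=\mathbb{R}/2\pi\mathbb{Z}$. **Definitions.** A closed geodesic is a nonconstant geodesic $\gamma\colon S^1\to M$; $l(\gamma)$ is its length. It is a $1/k$-geodesic if $d(\gamma(t),\gamma(t+2\pi/k))=l(\gamma)/k$ for all $t\in S^1$, and a strict one if moreover $\gamma(t+2\pi/k)$ is a cut point of $\gamma(t)$ for some $t$. For $q,p\in M$ let $\widehat{qp}\subset T_qM$ be the set of initial velocities of unit-speed minimizing geodesics from $q$ to $p$. Indices of $\bar x=(x_1,\dots,x_k)\in M^k$ are taken modulo $k$, and the uniform energy is $E(\bar x)=\sum_{i=1}^k k\,d(x_i,x_{i+1})^2$. The point $\bar x$ is balanced if $d(x_{i-1},x_i)=d(x_i,x_{i+1})$ for all $i$ and there are $\xi_i\in\widehat{x_ix_{i+1}}$ with $-\xi_i\in\widehat{x_ix_{i-1}}$ for all $i$; it is non-smooth balanced if moreover $x_{i+1}$ is a cut point of $x_i$ for some $i$. For a closed geodesic $\gamma$ put $\bar\gamma(t)=(\gamma(t),\gamma(t+2\pi/k),\dots,\gamma(t+2\pi(k-1)/k))$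 and $C(\gamma)=\{\bar\gamma(t):t\in S^1\}\subset M^k$. The geodesic $\gamma$ is associated to $\bar x$ if, for some $t$, $\bar x=\bar\gamma(t)$ and $u_i=\dot\gamma(t_i)/|\dot\gamma(t_i)|$, $t_i=t+2\pi(i-1)/k$, satisfies $u_i\in\widehat{x_ix_{i+1}}$ and $-u_i\in\widehat{x_ix_{i-1}}$ for all $i$. A balanced point $\bar x$ is rotating via $\gamma$ if $\gamma$ is associated to $\bar x$ and every $\bar\gamma(t)$ is a balanced point with associated geodesic $\gamma$; then $C(\gamma)$ is called a class of balanced points. A class is non-smooth if it contains a non-smooth balanced point, and of nonzero energy if $E\neq 0$ on it. Finally, the reversal of $C\subset M^k$ is $\{(x_k,\dots,x_1):(x_1,\dots,x_k)\in C\}$. **Theorem.** The assignment $\gamma\mapsto C(\gamma)$ gives a one-to-one correspondence between the strict $1/k$-geodesics in $M$ and the non-smooth classes of balanced points of the uniform energy in $M^k$ of nonzero energy, in the following sense. 1. If $\gamma$ is a strict $1/k$-geodesic, then $C(\gamma)$ is a non-smooth class of balanced points of nonzero energy, and each of its points is rotating via $\gamma$. 2. Every non-smooth class of balanced points of nonzero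 energy equals $C(\gamma)$ for some strict $1/k$-geodesic $\gamma$. 3. For strict $1/k$-geodesics $\gamma,\sigma$, one has $C(\gamma)=C(\sigma)$ if and only if either $\sigma(t)=\gamma(t+s)$ for some $s$ and all $t$, or $k$ is even, $\gamma$ is $4\pi/k$-periodic (which is automatic for $k=2$), and $\sigma(t)=\gamma(s-t)$ for some $s$ and all $t$. 4. Consequently $\gamma\mapsto C(\gamma)$ induces a bijection from the set of strict $1/k$-geodesics, up to the choice of base point and orientation, onto the set of non-smooth classes of balanced points of nonzero energy, up to reversal. -/

import Mathlib

open Set Function Bundle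
open scoped Manifold ContDiff

noncomputable section

namespace UniformEnergy

/-! ### Geodesics of a Riemannian manifold -/

section Geodesics

variable (n : ℕ) {M : Type*} [TopologicalSpace M] [ChartedSpace (EuclideanSpace ℝ (Fin n)) M]

/-- The velocity `γ'(t)` of a curve `γ : ℝ → M`, a tangent vector at `γ t`. -/
def velocity (γ : ℝ → M) (t : ℝ) : TangentSpace (𝓡 n) (γ t) :=
  mfderiv 𝓘(ℝ, ℝ) (𝓡 n) γ t (1 : ℝ)

variable [RiemannianBundle (fun x : M ↦ TangentSpace (𝓡 n) x)]

/-- The Riemannian metric read in the chart `φ` at `x₀`: the inner product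
`g_y(u, v) = ⟪dφ⁻¹_y u, dφ⁻¹_y v⟫` for `y` in the image of the chart. -/
def coordMetric (x₀ : M) (y u v : EuclideanSpace ℝ (Fin n)) : ℝ :=
  inner ℝ (mfderiv 𝓘(ℝ, EuclideanSpace ℝ (Fin n)) (𝓡 n) (extChartAt (𝓡 n) x₀).symm y u)
    (mfderiv 𝓘(ℝ, EuclideanSpace ℝ (Fin n)) (𝓡 n) (extChartAt (𝓡 n) x₀).symm y v)

/-- The Christoffel symbols of the first kind of the Levi-Civita connection in the chart at `x₀`:
`Γ_y(u, v; w) = (∂_u g(v, w) + ∂_v g(u, w) - ∂_w g(u, v)) / 2`, so that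
`Γ(e_i, e_j; e_l) = ∑ m, g_{lm} Γ^m_{ij}`. -/
def christoffel (x₀ : M) (y u v w : EuclideanSpace ℝ (Fin n)) : ℝ :=
  (fderiv ℝ (fun z ↦ coordMetric n x₀ z v w) y u
    + fderiv ℝ (fun z ↦ coordMetric n x₀ z u w) y v
    - fderiv ℝ (fun z ↦ coordMetric n x₀ z u v) y w) / 2

/-- A geodesic `γ : ℝ → M`: a smooth curve that satisfies the geodesic equation in every
chart. With `c = φ ∘ γ` the equation is `g(c'', w) + Γ(c', c'; w) = 0` for all `w`, that is,
`c''ᵐ + ∑ i j, Γᵐ_{ij} c'ⁱ c'ʲ = 0` with its index lowered. On a complete manifold every geodesic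
extends to the whole real line. -/
def IsGeodesic (γ : ℝ → M) : Prop :=
  ContMDiff 𝓘(ℝ, ℝ) (𝓡 n) ∞ γ ∧
  ∀ (x₀ : M) (t : ℝ), γ t ∈ (extChartAt (𝓡 n) x₀).source →
    ∀ w : EuclideanSpace ℝ (Fin n),
      coordMetric n x₀ (extChartAt (𝓡 n) x₀ (γ t))
          (deriv (deriv fun s ↦ extChartAt (𝓡 n) x₀ (γ s)) t) w
        + christoffel n x₀ (extChartAt (𝓡 n) x₀ (γ t))
          (deriv (fun s ↦ extChartAt (𝓡 n) x₀ (γ s)) t)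
          (deriv (fun s ↦ extChartAt (𝓡 n) x₀ (γ s)) t) w = 0

/-- The normalized velocity `γ'(t) / |γ'(t)|`. -/
def direction (γ : ℝ → M) (t : ℝ) : TangentSpace (𝓡 n) (γ t) :=
  ‖velocity n γ t‖⁻¹ • velocity n γ t

/-- A unit-speed geodesic. -/
def IsUnitGeodesic (γ : ℝ → M) : Prop :=
  IsGeodesic n γ ∧ ∀ t, ‖velocity n γ t‖ = 1

/-- A closed geodesic `γ : S¹ → M`, with `S¹ = ℝ / 2πℤ`: a nonconstant `2π`-periodic geodesic. -/
def IsClosedGeodesic (γ : ℝ → M) : Prop :=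
  IsGeodesic n γ ∧ Periodic γ (2 * Real.pi) ∧ ∃ s t, γ s ≠ γ t

/-- The length `l(γ)` of a curve `γ : S¹ → M`, that is, of `γ` over one period `[0, 2π]`. -/
def circleLength (γ : ℝ → M) : ℝ :=
  (Manifold.pathELength (𝓡 n) γ 0 (2 * Real.pi)).toReal

end Geodesics

/-! ### Minimizing geodesics, cut points, `1/k`-geodesics and balanced points -/

section Balanced

variable (n : ℕ) {M : Type*} [MetricSpace M] [ChartedSpace (EuclideanSpace ℝ (Fin n)) M]
  [RiemannianBundle (fun x : M ↦ TangentSpace (𝓡 n) x)]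

/-- The set of initial velocities in `T_q M` of the unit-speed minimizing geodesics
`σ : [0, d(q, p)] → M` joining `q` to `p`. -/
def minDirections (q p : M) : Set (TangentSpace (𝓡 n) q) :=
  {v | ∃ σ : ℝ → M, IsUnitGeodesic n σ ∧ σ (dist q p) = p ∧
    (⟨σ 0, velocity n σ 0⟩ : TangentBundle (𝓡 n) M) = ⟨q, v⟩}

/-- `q` is a cut point of `p`: there are a unit-speed geodesic `γ` from `p` and `t₀ > 0` with
`q = γ t₀` such that the set of `t ≥ 0` with `d(p, γ t) = t` is `[0, t₀]`. -/
def IsCutPoint (p q : M) : Prop :=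
  ∃ γ : ℝ → M, IsUnitGeodesic n γ ∧ γ 0 = p ∧
    ∃ t₀ : ℝ, 0 < t₀ ∧ γ t₀ = q ∧ {t : ℝ | 0 ≤ t ∧ dist p (γ t) = t} = Icc 0 t₀

variable (k : ℕ)

/-- A `1/k`-geodesic: a closed geodesic `γ` with `d(γ(t), γ(t + 2π/k)) = l(γ)/k` for all `t`. -/
def IsOneDivGeodesic (γ : ℝ → M) : Prop :=
  IsClosedGeodesic n γ ∧ ∀ t, dist (γ t) (γ (t + 2 * Real.pi / k)) = circleLength n γ / k

/-- A strict `1/k`-geodesic: a `1/k`-geodesic containing a pair of cut points at distance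
`l(γ)/k` along `γ`. -/
def IsStrictOneDivGeodesic (γ : ℝ → M) : Prop :=
  IsOneDivGeodesic n k γ ∧ ∃ t, IsCutPoint n (γ t) (γ (t + 2 * Real.pi / k))

/-- The `k`-tuple `(γ(t), γ(t + 2π/k), …, γ(t + 2π(k-1)/k))`. -/
def tuple (γ : ℝ → M) (t : ℝ) : Fin k → M :=
  fun i ↦ γ (t + 2 * Real.pi * (i : ℕ) / k)

/-- The set `{(γ(t), γ(t + 2π/k), …, γ(t + 2π(k-1)/k)) : t ∈ S¹}` in `M ^ k`. -/
def tupleClass (γ : ℝ → M) : Set (Fin k → M) :=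
  range (tuple k γ)

variable {k} [NeZero k]

/-- The uniform energy `E : M ^ k → ℝ`; indices are cyclic (addition in `Fin k` is modulo `k`). -/
def uniformEnergy (x : Fin k → M) : ℝ :=
  ∑ i, dist (x i) (x (i + 1)) ^ 2 / (1 / (k : ℝ))

/-- A balanced point of the uniform energy. -/
def IsBalanced (x : Fin k → M) : Prop :=
  (∀ i, dist (x (i - 1)) (x i) = dist (x i) (x (i + 1))) ∧
  ∃ ξ : (i : Fin k) → TangentSpace (𝓡 n) (x i),
    ∀ i, ξ i ∈ minDirections n (x i) (x (i + 1)) ∧ -ξ i ∈ minDirections n (x i) (x (i - 1))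

/-- A non-smooth balanced point: at least one pair `(x_i, x_{i+1})` is a pair of cut points. -/
def IsNonsmoothBalanced (x : Fin k → M) : Prop :=
  IsBalanced n x ∧ ∃ i, IsCutPoint n (x i) (x (i + 1))

/-- The closed geodesic `γ` is associated to `x`: for some `t`, `x` is the `k`-tuple of `γ` at `t`,
and the unit direction of `γ` at each `x_i = γ(t + 2πi/k)` is the initial velocity of a
unit-speed minimizing geodesic to `x_{i+1}` and its negative is one of a unit-speed minimizing
geodesic to `x_{i-1}`. -/
def IsAssociated (γ : ℝ → M) (x : Fin k → M) : Prop :=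
  IsClosedGeodesic n γ ∧ ∃ t, x = tuple k γ t ∧ ∀ i : Fin k,
    direction n γ (t + 2 * Real.pi * (i : ℕ) / k) ∈
      minDirections n (γ (t + 2 * Real.pi * (i : ℕ) / k)) (x (i + 1)) ∧
    -direction n γ (t + 2 * Real.pi * (i : ℕ) / k) ∈
      minDirections n (γ (t + 2 * Real.pi * (i : ℕ) / k)) (x (i - 1))

/-- The balanced point `x` is rotating, by means of its associated closed geodesic `γ`: every
`k`-tuple of `γ` is a balanced point with associated closed geodesic `γ`. -/
def IsRotatingVia (γ : ℝ → M) (x : Fin k → M) : Prop :=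
  IsBalanced n x ∧ IsAssociated n γ x ∧
    ∀ t, IsBalanced n (tuple k γ t) ∧ IsAssociated n γ (tuple k γ t)

/-- A class of balanced points: the set of all `k`-tuples of a closed geodesic by means of which
some balanced point is rotating. -/
def IsBalancedClass (C : Set (Fin k → M)) : Prop :=
  ∃ (γ : ℝ → M) (x : Fin k → M), IsRotatingVia n γ x ∧ C = tupleClass k γ

/-- A non-smooth class of balanced points, all of nonzero energy. -/
def IsNonsmoothClass (C : Set (Fin k → M)) : Prop :=
  IsBalancedClass n C ∧ (∃ x ∈ C, IsNonsmoothBalanced n x) ∧ ∀ x ∈ C, uniformEnergy x ≠ 0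

end Balanced

/-! ### Change of base point and reversal of the orientation -/

section Quotients

variable {M : Type*}

/-- `σ` differs from `γ` by a rotation of `S¹`. -/
def IsRotationOf (σ γ : ℝ → M) : Prop := ∃ s, ∀ t, σ t = γ (t + s)

/-- `σ` differs from `γ` by a reflection of `S¹`: the same curve with the opposite orientation. -/
def IsReflectionOf (σ γ : ℝ → M) : Prop := ∃ s, ∀ t, σ t = γ (s - t)

/-- The set of all `(x_k, …, x_1)` with `(x_1, …, x_k) ∈ C`. -/
def reverseClass {k : ℕ} (C : Set (Fin k → M)) : Set (Fin k → M) :=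
  (fun x i ↦ x (Fin.rev i)) '' C

theorem reverseClass_reverseClass {k : ℕ} (C : Set (Fin k → M)) :
    reverseClass (reverseClass C) = C := by
  simp [reverseClass, image_image]

variable (M) (n : ℕ) [MetricSpace M] [ChartedSpace (EuclideanSpace ℝ (Fin n)) M]
  [RiemannianBundle (fun x : M ↦ TangentSpace (𝓡 n) x)] (k : ℕ)

/-- Strict `1/k`-geodesics up to the choice of base point and orientation. -/
def strictSetoid : Setoid {γ : ℝ → M // IsStrictOneDivGeodesic n k γ} where
  r γ σ := IsRotationOf σ.1 γ.1 ∨ IsReflectionOf σ.1 γ.1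
  iseqv :=
    { refl := fun γ ↦ Or.inl ⟨0, fun t ↦ by simp⟩
      symm := by
        rintro γ σ (⟨s, h⟩ | ⟨s, h⟩)
        · exact Or.inl ⟨-s, fun t ↦ by simp [h]⟩
        · exact Or.inr ⟨s, fun t ↦ by simp [h]⟩
      trans := by
        rintro γ σ τ (⟨s, h⟩ | ⟨s, h⟩) (⟨r, h'⟩ | ⟨r, h'⟩)
        · exact Or.inl ⟨r + s, fun t ↦ by rw [h', h, add_assoc]⟩
        · exact Or.inr ⟨r + s, fun t ↦ by simp only [h', h]; ring_nf⟩
        · exact Or.inr ⟨s - r, fun t ↦ by simp only [h', h]; ring_nf⟩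
        · exact Or.inl ⟨s - r, fun t ↦ by simp only [h', h]; ring_nf⟩ }

/-- Non-smooth classes of nonzero energy up to reversal of the order in the tuples. -/
def classSetoid [NeZero k] : Setoid {C : Set (Fin k → M) // IsNonsmoothClass n C} where
  r C D := D.1 = C.1 ∨ D.1 = reverseClass C.1
  iseqv :=
    { refl := fun C ↦ Or.inl rfl
      symm := by
        rintro C D (h | h)
        · exact Or.inl h.symm
        · exact Or.inr (by rw [h, reverseClass_reverseClass])
      trans := by
        rintro C D F (h | h) (h' | h')
        · exact Or.inl (h'.trans h)
        · exact Or.inr (by rw [h', h])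
        · exact Or.inr (by rw [h', h])
        · exact Or.inl (by rw [h', h, reverseClass_reverseClass]) }

end Quotients

end UniformEnergy

end

/-!
A geodesic is determined by its position and velocity at one time
(`IsGeodesic.eq_of_tangentLift_eq`, by the uniqueness theorem for the geodesic equation in charts),
and it has constant speed (`IsGeodesic.norm_velocity_eq`). Two consequences carry the proof.

First, the unit direction of a geodesic `γ` at time `t` is that of a minimizing geodesic to `p`
exactly if `γ` itself arrives at `p` after the time that `d(γ(t), p)` prescribes
(`IsGeodesic.direction_mem_minDirections_iff`). Since a `1/k`-geodesic `γ` of speed `v` has length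
`2πv`, its tuples are therefore balanced with associated geodesic `γ`.

Second, where two geodesics of the same speed meet, they either share their germ, up to the
orientation, or cross transversally, and transversal crossings are isolated. Hence a coincidence of
two geodesics at every time is a coincidence of germs off a countable set of times
(`IsGeodesic.countable_crossings`), and a nonconstant geodesic is never its own reversal
(`IsGeodesic.not_reflection`).

For a class rotating via `γ`, the association of each tuple gives a time `τ` with `γ(τ) = γ(t)` such
that `γ` runs from `γ(τ)` to `γ(t + 2π/k)` along a minimizing geodesic. Off a countable set of times
the germs at `τ` and `t` agree, so by continuity `γ(t + D(t)/v) = γ(t + 2π/k)` for all `t`, where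
`v` is the speed of `γ` and `D(t)` the distance from `γ(t)` to `γ(t + 2π/k)`. Then `D(t)/v - 2π/k`
is a period of `γ` for most `t`, so the continuous function `D` takes countably many values and is constant
(`exists_step_of_isAssociated`). An affine change of the parameter turns `γ` into a `1/k`-geodesic
with the same tuples (`exists_isOneDivGeodesic`).

If two `1/k`-geodesics have the same tuples, they share a germ up to the orientation, so that one is
a rotation or a reflection of the other. In the second case both neighbours of a point in its
tuple are the same, which makes `4π/k` a period and `k` even
(`IsOneDivGeodesic.isRotationOf_or_isReflectionOf`). As this holds for all `1/k`-geodesics, strict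
or not, it applies to reversed geodesics too and yields the injectivity up to orientation.
-/

noncomputable section

namespace UniformEnergy

open Filter Topology

/-! ### The metric as a bilinear form in coordinates -/

section Bilinear

variable {n : ℕ} {M : Type*} [TopologicalSpace M] [ChartedSpace (EuclideanSpace ℝ (Fin n)) M]
  [RiemannianBundle (fun x : M ↦ TangentSpace (𝓡 n) x)]

theorem coordMetric_comm (x₀ : M) (y u v : EuclideanSpace ℝ (Fin n)) :
    coordMetric n x₀ y u v = coordMetric n x₀ y v u :=
  real_inner_comm _ _

theorem coordMetric_add_left (x₀ : M) (y u u' v : EuclideanSpace ℝ (Fin n)) :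
    coordMetric n x₀ y (u + u') v = coordMetric n x₀ y u v + coordMetric n x₀ y u' v :=
  (congrArg (inner ℝ · _) (map_add (mfderiv 𝓘(ℝ, EuclideanSpace ℝ (Fin n)) (𝓡 n)
    (extChartAt (𝓡 n) x₀).symm y) u u')).trans (inner_add_left _ _ _)

theorem coordMetric_smul_left (x₀ : M) (a : ℝ) (y u v : EuclideanSpace ℝ (Fin n)) :
    coordMetric n x₀ y (a • u) v = a * coordMetric n x₀ y u v :=
  (congrArg (inner ℝ · _) (map_smul (mfderiv 𝓘(ℝ, EuclideanSpace ℝ (Fin n)) (𝓡 n)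
    (extChartAt (𝓡 n) x₀).symm y) a u)).trans (real_inner_smul_left _ _ _)

theorem coordMetric_add_right (x₀ : M) (y u v v' : EuclideanSpace ℝ (Fin n)) :
    coordMetric n x₀ y u (v + v') = coordMetric n x₀ y u v + coordMetric n x₀ y u v' := by
  simp only [coordMetric_comm x₀ y u, coordMetric_add_left]

theorem coordMetric_smul_right (x₀ : M) (a : ℝ) (y u v : EuclideanSpace ℝ (Fin n)) :
    coordMetric n x₀ y u (a • v) = a * coordMetric n x₀ y u v := by
  simp only [coordMetric_comm x₀ y u, coordMetric_smul_left]

end Bilinear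

/-! ### Curves in coordinates -/

section Coordinates

variable (n : ℕ) {M : Type*} [TopologicalSpace M] [ChartedSpace (EuclideanSpace ℝ (Fin n)) M]

/-- The canonical lift `t ↦ (γ t, γ' t)` of a curve to the tangent bundle. Velocities at base points
that are equal, but not definitionally so, are compared as points of the total space. -/
def tangentLift (γ : ℝ → M) (t : ℝ) : TangentBundle (𝓡 n) M := ⟨γ t, velocity n γ t⟩

variable {n}

theorem tangentLift_congr {γ σ : ℝ → M} {t : ℝ} (h : γ =ᶠ[𝓝 t] σ) :
    tangentLift n γ t = tangentLift n σ t := by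
  have h1 : mfderiv 𝓘(ℝ, ℝ) (𝓡 n) γ t = mfderiv 𝓘(ℝ, ℝ) (𝓡 n) σ t := h.mfderiv_eq
  refine TotalSpace.ext h.eq_of_nhds (heq_of_eq ?_)
  exact congrArg (fun L : ℝ →L[ℝ] EuclideanSpace ℝ (Fin n) ↦ L 1) h1

theorem eventually_mem_source {x₀ : M} {γ : ℝ → M} {t : ℝ} (hγ : ContinuousAt γ t)
    (ht : γ t ∈ (extChartAt (𝓡 n) x₀).source) :
    ∀ᶠ s in 𝓝 t, γ s ∈ (extChartAt (𝓡 n) x₀).source :=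
  hγ.eventually_mem ((isOpen_extChartAt_source x₀).mem_nhds ht)

/-- The curve `γ` read in the chart at `x₀`; it is meaningful only while `γ` stays in the source of
that chart. -/
abbrev coordCurve (n : ℕ) {M : Type*} [TopologicalSpace M]
    [ChartedSpace (EuclideanSpace ℝ (Fin n)) M] (x₀ : M) (γ : ℝ → M) :
    ℝ → EuclideanSpace ℝ (Fin n) :=
  fun s ↦ extChartAt (𝓡 n) x₀ (γ s)

theorem coordCurve_affine (x₀ : M) (γ : ℝ → M) (a b : ℝ) :
    deriv (coordCurve n x₀ fun s ↦ γ (a * s + b)) =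
      fun s ↦ a • deriv (coordCurve n x₀ γ) (a * s + b) := by
  funext s
  have h1 := deriv_comp_mul_left (𝕜 := ℝ) a (fun u ↦ coordCurve n x₀ γ (u + b)) s
  rw [deriv_comp_add_const (coordCurve n x₀ γ)] at h1
  exact h1

theorem deriv_deriv_coordCurve_affine (x₀ : M) (γ : ℝ → M) (a b s : ℝ) :
    deriv (deriv (coordCurve n x₀ fun s ↦ γ (a * s + b))) s =
      a ^ 2 • deriv (deriv (coordCurve n x₀ γ)) (a * s + b) := by
  rw [coordCurve_affine, deriv_fun_const_smul_field]
  have h1 := deriv_comp_mul_left (𝕜 := ℝ) a (fun u ↦ deriv (coordCurve n x₀ γ) (u + b)) s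
  rw [deriv_comp_add_const (deriv (coordCurve n x₀ γ))] at h1
  rw [h1, smul_smul, sq]

theorem contDiff_affine (a b : ℝ) : ContDiff ℝ ∞ fun s : ℝ ↦ a * s + b :=
  (contDiff_const.mul contDiff_id).add contDiff_const

theorem velocity_comp_affine {γ : ℝ → M} (hγ : ContMDiff 𝓘(ℝ, ℝ) (𝓡 n) ∞ γ) (a b s : ℝ) :
    velocity n (fun s ↦ γ (a * s + b)) s = a • velocity n γ (a * s + b) := by
  have hd : HasDerivAt (fun s : ℝ ↦ a * s + b) a s := by
    simpa using ((hasDerivAt_id s).const_mul a).add_const b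
  have h := mfderiv_comp_apply (I := 𝓘(ℝ, ℝ)) (I' := 𝓘(ℝ, ℝ)) (I'' := 𝓡 n) s (g := γ)
    (f := fun s : ℝ ↦ a * s + b) (hγ.mdifferentiableAt (by simp))
    hd.differentiableAt.mdifferentiableAt (1 : ℝ)
  have h2 : mfderiv 𝓘(ℝ, ℝ) 𝓘(ℝ, ℝ) (fun s : ℝ ↦ a * s + b) s (1 : ℝ) = a := by
    rw [mfderiv_eq_fderiv]
    exact hd.deriv
  refine h.trans ?_
  have h3 := map_smul (mfderiv 𝓘(ℝ, ℝ) (𝓡 n) γ (a * s + b)) a (1 : ℝ)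
  refine Eq.trans ?_ h3
  refine congrArg (mfderiv 𝓘(ℝ, ℝ) (𝓡 n) γ (a * s + b)) (h2.trans ?_)
  exact (mul_one a).symm

theorem velocity_const (p : M) (t : ℝ) : velocity n (fun _ : ℝ ↦ p) t = 0 := by
  unfold velocity
  rw [mfderiv_const]
  rfl

variable [IsManifold (𝓡 n) ∞ M]

theorem mdifferentiableAt_symm {x₀ : M} {y : EuclideanSpace ℝ (Fin n)}
    (hy : y ∈ (extChartAt (𝓡 n) x₀).target) :
    MDifferentiableAt 𝓘(ℝ, EuclideanSpace ℝ (Fin n)) (𝓡 n) (extChartAt (𝓡 n) x₀).symm y := by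
  have h := mdifferentiableWithinAt_extChartAt_symm hy
  rwa [ModelWithCorners.range_eq_univ, mdifferentiableWithinAt_univ] at h

theorem mfderiv_symm_injective {x₀ : M} {y : EuclideanSpace ℝ (Fin n)}
    (hy : y ∈ (extChartAt (𝓡 n) x₀).target) :
    Injective (mfderiv 𝓘(ℝ, EuclideanSpace ℝ (Fin n)) (𝓡 n) (extChartAt (𝓡 n) x₀).symm y) := by
  have h := isInvertible_mfderivWithin_extChartAt_symm hy
  rw [ModelWithCorners.range_eq_univ, mfderivWithin_univ] at h
  exact h.injective

theorem contDiffAt_coordCurve {x₀ : M} {γ : ℝ → M} {t : ℝ}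
    (hγ : ContMDiff 𝓘(ℝ, ℝ) (𝓡 n) ∞ γ)
    (ht : γ t ∈ (extChartAt (𝓡 n) x₀).source) : ContDiffAt ℝ ∞ (coordCurve n x₀ γ) t := by
  rw [← contMDiffAt_iff_contDiffAt]
  rw [extChartAt_source] at ht
  exact (contMDiffAt_extChartAt' ht).comp t hγ.contMDiffAt

/-- The lift of a curve to the tangent bundle, recovered from the chart expression of the
curve. -/
theorem tangentLift_eq {x₀ : M} {γ : ℝ → M} {t : ℝ} (hγ : ContMDiff 𝓘(ℝ, ℝ) (𝓡 n) ∞ γ)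
    (ht : γ t ∈ (extChartAt (𝓡 n) x₀).source) :
    tangentLift n γ t = ⟨(extChartAt (𝓡 n) x₀).symm (coordCurve n x₀ γ t),
      mfderiv 𝓘(ℝ, EuclideanSpace ℝ (Fin n)) (𝓡 n) (extChartAt (𝓡 n) x₀).symm
        (coordCurve n x₀ γ t) (deriv (coordCurve n x₀ γ) t)⟩ := by
  have h1 : γ =ᶠ[𝓝 t] (extChartAt (𝓡 n) x₀).symm ∘ coordCurve n x₀ γ := by
    filter_upwards [eventually_mem_source hγ.continuous.continuousAt ht] with s hs
    exact ((extChartAt (𝓡 n) x₀).left_inv hs).symm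
  have hd : DifferentiableAt ℝ (coordCurve n x₀ γ) t :=
    (contDiffAt_coordCurve hγ ht).differentiableAt (by simp)
  have hy := (extChartAt (𝓡 n) x₀).map_source ht
  rw [tangentLift_congr h1]
  unfold tangentLift velocity
  congr 1
  exact (mfderiv_comp_apply t (mdifferentiableAt_symm hy) hd.mdifferentiableAt (1 : ℝ)).trans
    (by rw [mfderiv_eq_fderiv]; rfl)

/-- The coordinates of the velocity are the differential of the chart at the velocity, so curves
with the same lift have the same coordinate velocity. -/
theorem deriv_coordCurve {x₀ : M} {γ : ℝ → M} {t : ℝ} (hγ : ContMDiff 𝓘(ℝ, ℝ) (𝓡 n) ∞ γ)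
    (ht : γ t ∈ (extChartAt (𝓡 n) x₀).source) :
    deriv (coordCurve n x₀ γ) t =
      mfderiv (𝓡 n) 𝓘(ℝ, EuclideanSpace ℝ (Fin n)) (extChartAt (𝓡 n) x₀)
        (tangentLift n γ t).1 (tangentLift n γ t).2 := by
  have h := mfderiv_comp_apply (I := 𝓘(ℝ, ℝ)) (I' := 𝓡 n)
    (I'' := 𝓘(ℝ, EuclideanSpace ℝ (Fin n))) t (g := extChartAt (𝓡 n) x₀) (f := γ)
    (mdifferentiableAt_extChartAt (by rwa [extChartAt_source] at ht))
    (hγ.mdifferentiableAt (by simp)) (1 : ℝ)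
  rw [mfderiv_eq_fderiv] at h
  exact h

theorem hasDerivAt_coordCurve {x₀ : M} {γ : ℝ → M} {t : ℝ} (hγ : ContMDiff 𝓘(ℝ, ℝ) (𝓡 n) ∞ γ)
    (ht : γ t ∈ (extChartAt (𝓡 n) x₀).source) :
    HasDerivAt (coordCurve n x₀ γ) (deriv (coordCurve n x₀ γ) t) t :=
  ((contDiffAt_coordCurve hγ ht).differentiableAt (by simp)).hasDerivAt

theorem hasDerivAt_deriv_coordCurve {x₀ : M} {γ : ℝ → M} {t : ℝ}
    (hγ : ContMDiff 𝓘(ℝ, ℝ) (𝓡 n) ∞ γ) (ht : γ t ∈ (extChartAt (𝓡 n) x₀).source) :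
    HasDerivAt (deriv (coordCurve n x₀ γ)) (deriv (deriv (coordCurve n x₀ γ)) t) t := by
  have h : ContDiffAt ℝ 1 (deriv (coordCurve n x₀ γ)) t := by
    have h1 := (contDiffAt_coordCurve hγ ht).fderiv_right (m := 1) (by norm_cast)
    exact h1.clm_apply (contDiffAt_const (c := (1 : ℝ)))
  exact (h.differentiableAt (by simp)).hasDerivAt

/-- In a chart, a tangent vector is determined by its base point and its coordinates. -/
theorem tangentLift_eq_of_coord {x₀ : M} {γ σ : ℝ → M} {t : ℝ}
    (hγ : ContMDiff 𝓘(ℝ, ℝ) (𝓡 n) ∞ γ) (hσ : ContMDiff 𝓘(ℝ, ℝ) (𝓡 n) ∞ σ)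
    (ht : γ t ∈ (extChartAt (𝓡 n) x₀).source) (h : γ t = σ t)
    (hd : deriv (coordCurve n x₀ γ) t = deriv (coordCurve n x₀ σ) t) :
    tangentLift n γ t = tangentLift n σ t := by
  have h1 : coordCurve n x₀ γ t = coordCurve n x₀ σ t := by simp only [coordCurve, h]
  rw [tangentLift_eq hγ ht, tangentLift_eq hσ (h ▸ ht), h1]
  exact congrArg (fun u : EuclideanSpace ℝ (Fin n) ↦ (⟨(extChartAt (𝓡 n) x₀).symm
    (coordCurve n x₀ σ t), mfderiv 𝓘(ℝ, EuclideanSpace ℝ (Fin n)) (𝓡 n)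
      (extChartAt (𝓡 n) x₀).symm (coordCurve n x₀ σ t) u⟩ : TangentBundle (𝓡 n) M)) hd

variable [RiemannianBundle (fun x : M ↦ TangentSpace (𝓡 n) x)]

/-- The metric is nondegenerate in coordinates, because the inverse of a chart is an immersion. -/
theorem coordMetric_self_eq_zero {x₀ : M} {y u : EuclideanSpace ℝ (Fin n)}
    (hy : y ∈ (extChartAt (𝓡 n) x₀).target) (h : coordMetric n x₀ y u u = 0) : u = 0 := by
  unfold coordMetric at h
  rw [real_inner_self_eq_norm_sq, sq_eq_zero_iff, norm_eq_zero] at h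
  exact mfderiv_symm_injective hy (h.trans (map_zero _).symm)

/-- The squared speed of a curve, in coordinates. -/
theorem norm_velocity_sq {x₀ : M} {γ : ℝ → M} {t : ℝ} (hγ : ContMDiff 𝓘(ℝ, ℝ) (𝓡 n) ∞ γ)
    (ht : γ t ∈ (extChartAt (𝓡 n) x₀).source) :
    ‖velocity n γ t‖ ^ 2 = coordMetric n x₀ (coordCurve n x₀ γ t)
      (deriv (coordCurve n x₀ γ) t) (deriv (coordCurve n x₀ γ) t) := by
  have h := congrArg (fun p : TangentBundle (𝓡 n) M ↦ ‖p.2‖ ^ 2) (tangentLift_eq hγ ht)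
  unfold coordMetric
  rw [real_inner_self_eq_norm_sq]
  exact h

variable [IsContMDiffRiemannianBundle (𝓡 n) ∞ (EuclideanSpace ℝ (Fin n))
      (fun x : M ↦ TangentSpace (𝓡 n) x)]

/-- The metric has smooth coefficients: a constant vector field is smooth, so is its image under the
tangent map of the inverse chart, and the inner product of smooth fields is smooth. -/
theorem contDiffOn_coordMetric (x₀ : M) (u v : EuclideanSpace ℝ (Fin n)) :
    ContDiffOn ℝ ∞ (fun y ↦ coordMetric n x₀ y u v) (extChartAt (𝓡 n) x₀).target := by
  have hop := isOpen_extChartAt_target (I := 𝓡 n) x₀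
  have hs : ContMDiffOn 𝓘(ℝ, EuclideanSpace ℝ (Fin n)) (𝓡 n) ∞ (extChartAt (𝓡 n) x₀).symm
      (extChartAt (𝓡 n) x₀).target := contMDiffOn_extChartAt_symm x₀
  have key : ∀ w : EuclideanSpace ℝ (Fin n),
      ContMDiffOn 𝓘(ℝ, EuclideanSpace ℝ (Fin n)) ((𝓡 n).prod 𝓘(ℝ, EuclideanSpace ℝ (Fin n))) ∞
      (fun y : EuclideanSpace ℝ (Fin n) ↦ (⟨(extChartAt (𝓡 n) x₀).symm y,
        mfderiv 𝓘(ℝ, EuclideanSpace ℝ (Fin n)) (𝓡 n) (extChartAt (𝓡 n) x₀).symm y w⟩ :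
          TangentBundle (𝓡 n) M)) (extChartAt (𝓡 n) x₀).target := by
    intro w
    have h1 := hs.contMDiffOn_tangentMapWithin (m := ∞) (by simp) hop.uniqueMDiffOn
    have h2 : ContMDiff 𝓘(ℝ, EuclideanSpace ℝ (Fin n))
        (𝓘(ℝ, EuclideanSpace ℝ (Fin n)).prod 𝓘(ℝ, EuclideanSpace ℝ (Fin n))) ∞
        (fun y : EuclideanSpace ℝ (Fin n) ↦ (⟨y, w⟩ : TangentBundle
          𝓘(ℝ, EuclideanSpace ℝ (Fin n)) (EuclideanSpace ℝ (Fin n)))) := by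
      rw [contMDiff_vectorSpace_iff_contDiff (V := fun _ ↦ w)]
      exact contDiff_const
    have h3 := h1.comp (h2.contMDiffOn (s := (extChartAt (𝓡 n) x₀).target)) (fun y hy ↦ hy)
    refine h3.congr fun y hy ↦ ?_
    simp only [comp, tangentMapWithin]
    rw [mfderivWithin_of_isOpen hop hy]
  rw [← contMDiffOn_iff_contDiffOn]
  exact (key u).inner_bundle (key v)

end Coordinates

/-! ### The geodesic vector field in coordinates -/

section MetricTensor

variable {n : ℕ} {M : Type*} [TopologicalSpace M] [ChartedSpace (EuclideanSpace ℝ (Fin n)) M]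
  [RiemannianBundle (fun x : M ↦ TangentSpace (𝓡 n) x)]

/-- The metric read in the chart at `x₀`, as a function with values in the continuous bilinear
forms. -/
def metricForm (x₀ : M) (y : EuclideanSpace ℝ (Fin n)) :
    EuclideanSpace ℝ (Fin n) →L[ℝ] EuclideanSpace ℝ (Fin n) →L[ℝ] ℝ :=
  LinearMap.toContinuousLinearMap
    ((LinearMap.toContinuousLinearMap : (EuclideanSpace ℝ (Fin n) →ₗ[ℝ] ℝ) ≃ₗ[ℝ] _).toLinearMap ∘ₗ
      LinearMap.mk₂ ℝ (coordMetric n x₀ y) (coordMetric_add_left x₀ y)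
        (fun a u v ↦ coordMetric_smul_left x₀ a y u v) (coordMetric_add_right x₀ y)
        (fun a u v ↦ coordMetric_smul_right x₀ a y u v))

theorem christoffel_smul_smul (x₀ : M) (a : ℝ) (y u w : EuclideanSpace ℝ (Fin n)) :
    christoffel n x₀ y (a • u) (a • u) w = a ^ 2 * christoffel n x₀ y u u w := by
  unfold christoffel
  have h (f : EuclideanSpace ℝ (Fin n) → ℝ) (b : ℝ) :
      fderiv ℝ (fun z ↦ b * f z) y = b • fderiv ℝ f y :=
    congrFun (fderiv_const_smul_field (f := f) b) y
  simp only [coordMetric_smul_left, coordMetric_smul_right, h, map_smul, smul_eq_mul,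
    _root_.smul_apply]
  ring

theorem christoffel_self (x₀ : M) (y u : EuclideanSpace ℝ (Fin n)) :
    christoffel n x₀ y u u u = fderiv ℝ (fun z ↦ coordMetric n x₀ z u u) y u / 2 := by
  unfold christoffel
  ring

variable [IsManifold (𝓡 n) ∞ M]

theorem isInvertible_metricForm {x₀ : M} {y : EuclideanSpace ℝ (Fin n)}
    (hy : y ∈ (extChartAt (𝓡 n) x₀).target) : (metricForm x₀ y).IsInvertible := by
  have hinj : Injective (metricForm x₀ y).toLinearMap := by
    refine (injective_iff_map_eq_zero _).2 fun u hu ↦ coordMetric_self_eq_zero hy ?_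
    exact congrArg (fun L : EuclideanSpace ℝ (Fin n) →L[ℝ] ℝ ↦ L u) hu
  have hfr : Module.finrank ℝ (EuclideanSpace ℝ (Fin n)) =
      Module.finrank ℝ (EuclideanSpace ℝ (Fin n) →L[ℝ] ℝ) := by
    rw [← (LinearMap.toContinuousLinearMap : (EuclideanSpace ℝ (Fin n) →ₗ[ℝ] ℝ) ≃ₗ[ℝ] _).finrank_eq]
    exact Subspace.dual_finrank_eq.symm
  exact ⟨((metricForm x₀ y).toLinearMap.linearEquivOfInjective hinj hfr).toContinuousLinearEquiv,
    by ext; rfl⟩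

variable [IsContMDiffRiemannianBundle (𝓡 n) ∞ (EuclideanSpace ℝ (Fin n))
      (fun x : M ↦ TangentSpace (𝓡 n) x)]

theorem contDiffOn_metricForm (x₀ : M) :
    ContDiffOn ℝ ∞ (metricForm (n := n) x₀) (extChartAt (𝓡 n) x₀).target :=
  contDiffOn_clm_apply.2 fun u ↦ contDiffOn_clm_apply.2 fun v ↦ contDiffOn_coordMetric x₀ u v

theorem contDiffAt_metricForm {x₀ : M} {y : EuclideanSpace ℝ (Fin n)}
    (hy : y ∈ (extChartAt (𝓡 n) x₀).target) : ContDiffAt ℝ ∞ (metricForm x₀) y :=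
  (contDiffOn_metricForm x₀).contDiffAt ((isOpen_extChartAt_target x₀).mem_nhds hy)

/-- The metric is jointly smooth in the point and in both vectors. -/
theorem contDiffAt_coordMetric_triple {x₀ : M} {y : EuclideanSpace ℝ (Fin n)}
    (hy : y ∈ (extChartAt (𝓡 n) x₀).target) (u v : EuclideanSpace ℝ (Fin n)) :
    ContDiffAt ℝ ∞ (fun z : EuclideanSpace ℝ (Fin n) × EuclideanSpace ℝ (Fin n) ×
      EuclideanSpace ℝ (Fin n) ↦ coordMetric n x₀ z.1 z.2.1 z.2.2) (y, u, v) := by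
  have h : ContDiffAt ℝ ∞ (fun z : EuclideanSpace ℝ (Fin n) × EuclideanSpace ℝ (Fin n) ×
      EuclideanSpace ℝ (Fin n) ↦ metricForm x₀ z.1) (y, u, v) :=
    ContDiffAt.comp (g := metricForm x₀) (f := fun z : EuclideanSpace ℝ (Fin n) ×
      EuclideanSpace ℝ (Fin n) × EuclideanSpace ℝ (Fin n) ↦ z.1) _ (contDiffAt_metricForm hy)
      contDiffAt_fst
  exact (h.clm_apply (contDiff_fst.comp contDiff_snd).contDiffAt).clm_apply
    (contDiff_snd.comp contDiff_snd).contDiffAt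

theorem contDiffAt_christoffel {x₀ : M}
    {z : EuclideanSpace ℝ (Fin n) × EuclideanSpace ℝ (Fin n)}
    (hz : z.1 ∈ (extChartAt (𝓡 n) x₀).target) (w : EuclideanSpace ℝ (Fin n)) :
    ContDiffAt ℝ 1 (fun z : EuclideanSpace ℝ (Fin n) × EuclideanSpace ℝ (Fin n) ↦
      christoffel n x₀ z.1 z.2 z.2 w) z := by
  have key (P Q R : EuclideanSpace ℝ (Fin n) × EuclideanSpace ℝ (Fin n) →
      EuclideanSpace ℝ (Fin n)) (hP : ContDiff ℝ ∞ P) (hQ : ContDiff ℝ ∞ Q)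
      (hR : ContDiff ℝ ∞ R) : ContDiffAt ℝ 1 (fun x ↦
        fderiv ℝ (fun q ↦ coordMetric n x₀ q (P x) (Q x)) x.1 (R x)) z := by
    refine (ContDiffAt.fderiv (n := ∞) (f := fun x q ↦ coordMetric n x₀ q (P x) (Q x)) ?_
      contDiffAt_fst (by norm_cast)).clm_apply (hR.contDiffAt.of_le (by norm_cast))
    exact (contDiffAt_coordMetric_triple hz (P z) (Q z)).comp (z, z.1)
      (g := fun z ↦ coordMetric n x₀ z.1 z.2.1 z.2.2)
      (f := fun q : (EuclideanSpace ℝ (Fin n) × EuclideanSpace ℝ (Fin n)) ×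
        EuclideanSpace ℝ (Fin n) ↦ (q.2, P q.1, Q q.1))
      (contDiff_snd.prodMk ((hP.comp contDiff_fst).prodMk (hQ.comp contDiff_fst))).contDiffAt
  have h1 := key Prod.snd (fun _ ↦ w) Prod.snd contDiff_snd contDiff_const contDiff_snd
  have h2 := key Prod.snd Prod.snd (fun _ ↦ w) contDiff_snd contDiff_snd contDiff_const
  exact ((h1.add h1).sub h2).div_const 2

/-- The covector `w ↦ Γ_y(p, p; w)`, as a function of the position `y` and the velocity `p`. It is
defined by its values on the standard basis, so that it is linear in `w` even where the metric is
not differentiable. -/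
def christoffelForm (x₀ : M) (z : EuclideanSpace ℝ (Fin n) × EuclideanSpace ℝ (Fin n)) :
    EuclideanSpace ℝ (Fin n) →L[ℝ] ℝ :=
  ∑ i, christoffel n x₀ z.1 z.2 z.2 (EuclideanSpace.single i 1) • EuclideanSpace.proj i

/-- The geodesic vector field in the chart at `x₀`, on pairs of a position and a velocity: the
geodesic equation solved for the acceleration. Outside the target of the chart, where the metric
need not be invertible, the value is meaningless. -/
def geodesicField (x₀ : M) (z : EuclideanSpace ℝ (Fin n) × EuclideanSpace ℝ (Fin n)) :
    EuclideanSpace ℝ (Fin n) × EuclideanSpace ℝ (Fin n) :=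
  (z.2, -(metricForm x₀ z.1).inverse (christoffelForm x₀ z))

theorem contDiffAt_geodesicField {x₀ : M}
    {z : EuclideanSpace ℝ (Fin n) × EuclideanSpace ℝ (Fin n)}
    (hz : z.1 ∈ (extChartAt (𝓡 n) x₀).target) : ContDiffAt ℝ 1 (geodesicField x₀) z := by
  have hg : ContDiffAt ℝ ∞ (metricForm x₀) z.1 := contDiffAt_metricForm hz
  have hg1 : ContDiffAt ℝ 1
      (fun w : EuclideanSpace ℝ (Fin n) × EuclideanSpace ℝ (Fin n) ↦ metricForm x₀ w.1) z :=
    (hg.of_le (by norm_cast)).comp z contDiffAt_fst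
  have hchr : ContDiffAt ℝ 1 (christoffelForm x₀) z := by
    unfold christoffelForm
    exact ContDiffAt.sum fun i _ ↦ (contDiffAt_christoffel hz _).smul contDiffAt_const
  have hinv := (isInvertible_metricForm hz).contDiffAt_map_inverse (n := 1)
  exact contDiffAt_snd.prodMk ((hinv.comp z hg1).clm_apply hchr).neg

/-- The product rule for the metric along a curve, in coordinates. -/
theorem hasDerivAt_coordMetric {x₀ : M} {c u v : ℝ → EuclideanSpace ℝ (Fin n)} {t : ℝ}
    {c' u' v' : EuclideanSpace ℝ (Fin n)} (hy : c t ∈ (extChartAt (𝓡 n) x₀).target)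
    (hc : HasDerivAt c c' t) (hu : HasDerivAt u u' t) (hv : HasDerivAt v v' t) :
    HasDerivAt (fun s ↦ coordMetric n x₀ (c s) (u s) (v s))
      (fderiv ℝ (fun z ↦ coordMetric n x₀ z (u t) (v t)) (c t) c'
        + coordMetric n x₀ (c t) u' (v t) + coordMetric n x₀ (c t) (u t) v') t := by
  have hH := ((contDiffAt_coordMetric_triple hy (u t) (v t)).differentiableAt
    (by simp)).hasFDerivAt
  set L := fderiv ℝ (fun z : EuclideanSpace ℝ (Fin n) × EuclideanSpace ℝ (Fin n) ×
      EuclideanSpace ℝ (Fin n) ↦ coordMetric n x₀ z.1 z.2.1 z.2.2) (c t, u t, v t)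
  have h := hH.comp_hasDerivAt t (hc.prodMk (hu.prodMk hv))
  have h1 : fderiv ℝ (fun z ↦ coordMetric n x₀ z (u t) (v t)) (c t) c' = L (c', 0, 0) := by
    have := HasFDerivAt.comp (f := fun z ↦ (z, u t, v t)) (c t) hH
      ((hasFDerivAt_id (c t)).prodMk
      ((hasFDerivAt_const (u t) (c t)).prodMk (hasFDerivAt_const (v t) (c t))))
    exact congrArg (fun A : EuclideanSpace ℝ (Fin n) →L[ℝ] ℝ ↦ A c') this.fderiv
  have h2 : coordMetric n x₀ (c t) u' (v t) = L (0, u', 0) := by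
    have := HasFDerivAt.comp (f := fun z ↦ (c t, z, v t)) (u t) hH
      ((hasFDerivAt_const (c t) (u t)).prodMk
      ((hasFDerivAt_id (u t)).prodMk (hasFDerivAt_const (v t) (u t))))
    exact congrArg (fun A : EuclideanSpace ℝ (Fin n) →L[ℝ] ℝ ↦ A u')
      ((((metricForm x₀ (c t)).flip (v t)).hasFDerivAt (x := u t)).unique this)
  have h3 : coordMetric n x₀ (c t) (u t) v' = L (0, 0, v') := by
    have := HasFDerivAt.comp (f := fun z ↦ (c t, u t, z)) (v t) hH
      ((hasFDerivAt_const (c t) (v t)).prodMk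
      ((hasFDerivAt_const (u t) (v t)).prodMk (hasFDerivAt_id (v t))))
    exact congrArg (fun A : EuclideanSpace ℝ (Fin n) →L[ℝ] ℝ ↦ A v')
      ((((metricForm x₀ (c t)) (u t)).hasFDerivAt (x := v t)).unique this)
  rw [h1, h2, h3, ← map_add, ← map_add]
  have hsum : (c', (0 : EuclideanSpace ℝ (Fin n)), (0 : EuclideanSpace ℝ (Fin n))) + (0, u', 0)
      + (0, 0, v') = (c', u', v') := by simp
  rw [hsum]
  exact h

end MetricTensor

/-! ### Uniqueness and constant speed of geodesics -/

section Geodesics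

variable {n : ℕ} {M : Type*} [TopologicalSpace M] [ChartedSpace (EuclideanSpace ℝ (Fin n)) M]
  [RiemannianBundle (fun x : M ↦ TangentSpace (𝓡 n) x)]

/-- Affine reparametrizations of geodesics are geodesics. -/
theorem IsGeodesic.comp_affine {γ : ℝ → M} (hγ : IsGeodesic n γ) (a b : ℝ) :
    IsGeodesic n fun s ↦ γ (a * s + b) := by
  refine ⟨hγ.1.comp (contDiff_affine a b).contMDiff, fun x₀ t ht w ↦ ?_⟩
  have h := hγ.2 x₀ (a * t + b) ht w
  have e1 := deriv_deriv_coordCurve_affine (n := n) x₀ γ a b t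
  have e2 := congrFun (coordCurve_affine (n := n) x₀ γ a b) t
  rw [e1, e2, christoffel_smul_smul, coordMetric_smul_left, ← mul_add, h, mul_zero]

theorem isGeodesic_const (p : M) : IsGeodesic n fun _ : ℝ ↦ p := by
  refine ⟨contMDiff_const, fun x₀ t _ w ↦ ?_⟩
  have h := christoffel_smul_smul x₀ 0 (extChartAt (𝓡 n) x₀ p) (0 : EuclideanSpace ℝ (Fin n)) w
  have h2 := coordMetric_smul_left x₀ 0 (extChartAt (𝓡 n) x₀ p) (0 : EuclideanSpace ℝ (Fin n)) w
  simp only [smul_zero, zero_mul, ne_eq, OfNat.ofNat_ne_zero, not_false_eq_true, zero_pow] at h h2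
  simp only [deriv_const', deriv_const, h, h2, add_zero]

variable [IsManifold (𝓡 n) ∞ M]

/-- In a chart, a geodesic together with its velocity is an integral curve of the geodesic vector
field. -/
theorem IsGeodesic.hasDerivAt_geodesicField {x₀ : M} {γ : ℝ → M} {t : ℝ} (hγ : IsGeodesic n γ)
    (ht : γ t ∈ (extChartAt (𝓡 n) x₀).source) :
    HasDerivAt (fun s ↦ (coordCurve n x₀ γ s, deriv (coordCurve n x₀ γ) s))
      (geodesicField x₀ (coordCurve n x₀ γ t, deriv (coordCurve n x₀ γ) t)) t := by
  have hy := (extChartAt (𝓡 n) x₀).map_source ht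
  have h := (hasDerivAt_coordCurve hγ.1 ht).prodMk (hasDerivAt_deriv_coordCurve hγ.1 ht)
  have key : metricForm x₀ (coordCurve n x₀ γ t) (deriv (deriv (coordCurve n x₀ γ)) t) =
      -christoffelForm x₀ (coordCurve n x₀ γ t, deriv (coordCurve n x₀ γ) t) := by
    refine ContinuousLinearMap.coe_injective
      ((EuclideanSpace.basisFun (Fin n) ℝ).toBasis.ext fun i ↦ ?_)
    have h1 := hγ.2 x₀ t ht (EuclideanSpace.single i 1)
    have h2 : christoffelForm x₀ (coordCurve n x₀ γ t, deriv (coordCurve n x₀ γ) t)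
        (EuclideanSpace.single i 1) = christoffel n x₀ (coordCurve n x₀ γ t)
          (deriv (coordCurve n x₀ γ) t) (deriv (coordCurve n x₀ γ) t)
          (EuclideanSpace.single i 1) := by
      simp [christoffelForm]
    simp only [OrthonormalBasis.coe_toBasis, EuclideanSpace.basisFun_apply]
    have h3 := eq_neg_of_add_eq_zero_left h1
    rw [← h2] at h3
    exact h3
  convert h using 1
  unfold geodesicField
  rw [← map_neg, ← key, (isInvertible_metricForm hy).inverse_apply_self]

variable [IsContMDiffRiemannianBundle (𝓡 n) ∞ (EuclideanSpace ℝ (Fin n))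
      (fun x : M ↦ TangentSpace (𝓡 n) x)]

/-- Local uniqueness of geodesics: the geodesic vector field is locally Lipschitz. -/
theorem IsGeodesic.eventuallyEq {γ σ : ℝ → M} {t : ℝ} (hγ : IsGeodesic n γ)
    (hσ : IsGeodesic n σ) (h : tangentLift n γ t = tangentLift n σ t) : γ =ᶠ[𝓝 t] σ := by
  have hp : γ t = σ t := congrArg TotalSpace.proj h
  have h1 : γ t ∈ (extChartAt (𝓡 n) (γ t)).source := mem_extChartAt_source _
  have h2 : σ t ∈ (extChartAt (𝓡 n) (γ t)).source := hp ▸ h1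
  have e1 := eventually_mem_source hγ.1.continuous.continuousAt h1
  have e2 := eventually_mem_source hσ.1.continuous.continuousAt h2
  have hd : deriv (coordCurve n (γ t) γ) t = deriv (coordCurve n (γ t) σ) t := by
    rw [deriv_coordCurve hγ.1 h1, deriv_coordCurve hσ.1 h2, h]
  obtain ⟨K, s, hs, hK⟩ := (contDiffAt_geodesicField (x₀ := γ t)
    (z := (coordCurve n (γ t) γ t, deriv (coordCurve n (γ t) γ) t))
    ((extChartAt (𝓡 n) (γ t)).map_source h1)).exists_lipschitzOnWith
  have hX := hγ.hasDerivAt_geodesicField h1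
  have hY := hσ.hasDerivAt_geodesicField h2
  have heq : (coordCurve n (γ t) γ t, deriv (coordCurve n (γ t) γ) t) =
      (coordCurve n (γ t) σ t, deriv (coordCurve n (γ t) σ) t) := by
    rw [hd]; simp only [coordCurve, ← hp]
  have key := ODE_solution_unique_of_eventually (v := fun _ ↦ geodesicField (γ t))
    (s := fun _ ↦ s) (K := K) (t₀ := t) (.of_forall fun _ ↦ hK)
    (f := fun s ↦ (coordCurve n (γ t) γ s, deriv (coordCurve n (γ t) γ) s))
    (g := fun s ↦ (coordCurve n (γ t) σ s, deriv (coordCurve n (γ t) σ) s))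
    ((e1.mono fun r hr ↦ hγ.hasDerivAt_geodesicField hr).and (hX.continuousAt.eventually_mem hs))
    ((e2.mono fun r hr ↦ hσ.hasDerivAt_geodesicField hr).and
      (hY.continuousAt.eventually_mem (heq ▸ hs))) heq
  filter_upwards [key, e1, e2] with r hr hr1 hr2
  exact (extChartAt (𝓡 n) (γ t)).injOn hr1 hr2 (congrArg Prod.fst hr)

/-- A geodesic is determined by its position and its velocity at one time. -/
theorem IsGeodesic.eq_of_tangentLift_eq [T2Space M] {γ σ : ℝ → M} {t : ℝ} (hγ : IsGeodesic n γ)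
    (hσ : IsGeodesic n σ) (h : tangentLift n γ t = tangentLift n σ t) : γ = σ := by
  -- the set where the germs agree is open and closed
  have hopen : IsOpen {s | γ =ᶠ[𝓝 s] σ} := isOpen_setOfPred_eventually_nhds
  have hclosed : IsClosed {s | γ =ᶠ[𝓝 s] σ} := by
    refine isClosed_of_closure_subset fun s hs ↦ hγ.eventuallyEq hσ ?_
    have hfr : ∃ᶠ r in 𝓝 s, γ =ᶠ[𝓝 r] σ := mem_closure_iff_frequently.1 hs
    have hp : γ s = σ s := tendsto_nhds_unique_of_frequently_eq hγ.1.continuous.continuousAt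
      hσ.1.continuous.continuousAt (hfr.mono fun r hr ↦ hr.eq_of_nhds)
    have h1 : γ s ∈ (extChartAt (𝓡 n) (γ s)).source := mem_extChartAt_source _
    refine tangentLift_eq_of_coord hγ.1 hσ.1 h1 hp ?_
    refine tendsto_nhds_unique_of_frequently_eq
      (hasDerivAt_deriv_coordCurve hγ.1 h1).continuousAt
      (hasDerivAt_deriv_coordCurve hσ.1 (hp ▸ h1)).continuousAt (hfr.mono fun r hr ↦ ?_)
    exact (hr.fun_comp (extChartAt (𝓡 n) (γ s))).deriv_eq
  have huniv := IsClopen.eq_univ ⟨hclosed, hopen⟩ ⟨t, hγ.eventuallyEq hσ h⟩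
  funext s
  have hs : s ∈ {s | γ =ᶠ[𝓝 s] σ} := huniv ▸ mem_univ s
  exact EventuallyEq.eq_of_nhds hs

/-- Geodesics have constant speed. -/
theorem IsGeodesic.norm_velocity_eq {γ : ℝ → M} (hγ : IsGeodesic n γ) (s t : ℝ) :
    ‖velocity n γ s‖ = ‖velocity n γ t‖ := by
  -- `g(c', c')' = 2 (g(c'', c') + Γ(c', c'; c'))`, which is twice the geodesic equation at `c'`
  have hder : ∀ t, HasDerivAt (fun s ↦ ‖velocity n γ s‖ ^ 2) 0 t := by
    intro t
    have h1 : γ t ∈ (extChartAt (𝓡 n) (γ t)).source := mem_extChartAt_source _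
    have hy := (extChartAt (𝓡 n) (γ t)).map_source h1
    have hd := hasDerivAt_deriv_coordCurve hγ.1 h1
    have h := hasDerivAt_coordMetric hy (hasDerivAt_coordCurve hγ.1 h1) hd hd
    have heq : (fun s ↦ ‖velocity n γ s‖ ^ 2) =ᶠ[𝓝 t] fun s ↦ coordMetric n (γ t)
        (coordCurve n (γ t) γ s) (deriv (coordCurve n (γ t) γ) s)
        (deriv (coordCurve n (γ t) γ) s) := by
      filter_upwards [eventually_mem_source hγ.1.continuous.continuousAt h1] with r hr
      exact norm_velocity_sq hγ.1 hr
    have h0 := hγ.2 (γ t) t h1 (deriv (coordCurve n (γ t) γ) t)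
    rw [christoffel_self] at h0
    refine (h.congr_of_eventuallyEq heq).congr_deriv ?_
    rw [coordMetric_comm (γ t) _ (deriv (coordCurve n (γ t) γ) t)
      (deriv (deriv (coordCurve n (γ t) γ)) t)]
    dsimp only [coordCurve] at h0 ⊢
    linarith
  have h := is_const_of_deriv_eq_zero (fun t ↦ (hder t).differentiableAt)
    (fun t ↦ (hder t).deriv) s t
  exact (sq_eq_sq₀ (norm_nonneg _) (norm_nonneg _)).1 h

end Geodesics

/-! ### Intersections of geodesics -/

/-- In a second countable space, a set all of whose points are isolated in it is countable. -/
theorem countable_of_isolated {X : Type*} [TopologicalSpace X] [SecondCountableTopology X]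
    {S : Set X} (h : ∀ x ∈ S, ∀ᶠ z in 𝓝[≠] x, z ∉ S) : S.Countable := by
  have hd : DiscreteTopology S := by
    refine discreteTopology_subtype_iff.2 fun x hx ↦ ?_
    rw [← disjoint_iff, disjoint_principal_right]
    exact h x hx
  have : Countable S := countable_of_Lindelof_of_discrete
  exact this

section Intersections

variable {n : ℕ} {M : Type*} [TopologicalSpace M] [ChartedSpace (EuclideanSpace ℝ (Fin n)) M]

/-- If two curves meet with linearly independent velocities, then nearby they meet only there. -/
theorem eventually_ne_of_linearIndependent [IsManifold (𝓡 n) ∞ M] {x₀ : M} {γ σ : ℝ → M}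
    {t τ : ℝ} (hγ : ContMDiff 𝓘(ℝ, ℝ) (𝓡 n) ∞ γ) (hσ : ContMDiff 𝓘(ℝ, ℝ) (𝓡 n) ∞ σ)
    (ht : γ t ∈ (extChartAt (𝓡 n) x₀).source) (hτ : σ τ ∈ (extChartAt (𝓡 n) x₀).source)
    (h : LinearIndependent ℝ ![deriv (coordCurve n x₀ γ) t, deriv (coordCurve n x₀ σ) τ]) :
    ∀ᶠ z : ℝ × ℝ in 𝓝[≠] (t, τ), γ z.1 ≠ σ z.2 := by
  have h1 := (hasDerivAt_coordCurve hγ ht).hasFDerivAt.comp (f := Prod.fst) (t, τ)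
    (hasFDerivAt_fst (p := (t, τ)))
  have h2 := (hasDerivAt_coordCurve hσ hτ).hasFDerivAt.comp (f := Prod.snd) (t, τ)
    (hasFDerivAt_snd (p := (t, τ)))
  have hF := h1.sub h2
  have hanti := LinearMap.exists_antilipschitzWith
    ((ContinuousLinearMap.toSpanSingleton ℝ (deriv (coordCurve n x₀ γ) t)).comp
        (ContinuousLinearMap.fst ℝ ℝ ℝ)
      - (ContinuousLinearMap.toSpanSingleton ℝ (deriv (coordCurve n x₀ σ) τ)).comp
        (ContinuousLinearMap.snd ℝ ℝ ℝ)).toLinearMap <| by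
    refine LinearMap.ker_eq_bot'.2 fun z hz ↦ ?_
    have hz' : z.1 • deriv (coordCurve n x₀ γ) t + (-z.2) • deriv (coordCurve n x₀ σ) τ = 0 := by
      rw [neg_smul, ← sub_eq_add_neg]
      exact hz
    obtain ⟨h1, h2⟩ := LinearIndependent.pair_iff.1 h _ _ hz'
    exact Prod.ext h1 (neg_eq_zero.1 h2)
  obtain ⟨K, -, hK⟩ := hanti
  filter_upwards [hF.eventually_ne (c := 0) ⟨K, hK⟩] with z hz heq
  exact hz (by simp [coordCurve, heq])

variable [RiemannianBundle (fun x : M ↦ TangentSpace (𝓡 n) x)]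

theorem IsGeodesic.circleLength_eq [IsManifold (𝓡 n) ∞ M]
    [IsContMDiffRiemannianBundle (𝓡 n) ∞ (EuclideanSpace ℝ (Fin n))
      (fun x : M ↦ TangentSpace (𝓡 n) x)] {γ : ℝ → M} (hγ : IsGeodesic n γ) :
    circleLength n γ = 2 * Real.pi * ‖velocity n γ 0‖ := by
  have h : ∀ t, ‖mfderiv 𝓘(ℝ, ℝ) (𝓡 n) γ t (1 : ℝ)‖ₑ = ENNReal.ofReal ‖velocity n γ 0‖ := by
    intro t
    rw [hγ.norm_velocity_eq 0 t, ofReal_norm]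
    rfl
  unfold circleLength
  rw [Manifold.pathELength_eq_lintegral_mfderiv_Icc]
  have h' : (fun t ↦ ‖mfderiv 𝓘(ℝ, ℝ) (𝓡 n) γ t (1 : ℝ)‖ₑ) =
    fun _ ↦ ENNReal.ofReal ‖velocity n γ 0‖ := funext h
  refine (congrArg (fun f ↦ (∫⁻ t in Icc 0 (2 * Real.pi), f t).toReal) h').trans ?_
  simp [mul_comm, Real.pi_pos.le]

variable [IsManifold (𝓡 n) ∞ M]
  [IsContMDiffRiemannianBundle (𝓡 n) ∞ (EuclideanSpace ℝ (Fin n))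
      (fun x : M ↦ TangentSpace (𝓡 n) x)]

theorem deriv_coordCurve_ne_zero {x₀ : M} {γ : ℝ → M} {t : ℝ} (hγ : IsGeodesic n γ)
    (h0 : ‖velocity n γ 0‖ ≠ 0) (ht : γ t ∈ (extChartAt (𝓡 n) x₀).source) :
    deriv (coordCurve n x₀ γ) t ≠ 0 := by
  intro h
  have h1 := norm_velocity_sq hγ.1 ht
  have h2 := coordMetric_smul_left x₀ 0 (coordCurve n x₀ γ t) (0 : EuclideanSpace ℝ (Fin n)) 0
  rw [smul_zero, zero_mul] at h2
  rw [h, h2, sq_eq_zero_iff, hγ.norm_velocity_eq t 0] at h1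
  exact h0 h1

theorem IsGeodesic.countable_fiber {γ : ℝ → M} (hγ : IsGeodesic n γ)
    (h0 : ‖velocity n γ 0‖ ≠ 0) (p : M) : {r | γ r = p}.Countable := by
  refine countable_of_isolated fun r hr ↦ ?_
  have h1 : γ r ∈ (extChartAt (𝓡 n) (γ r)).source := mem_extChartAt_source _
  filter_upwards [(hasDerivAt_coordCurve hγ.1 h1).eventually_ne
    (deriv_coordCurve_ne_zero hγ h0 h1) (c := extChartAt (𝓡 n) (γ r) p)] with z hz hz'
  exact hz (congrArg _ hz')

/-- A geodesic is not its own reversal: its velocity would vanish at the centre of the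
reflection. -/
theorem IsGeodesic.not_reflection {γ : ℝ → M} (hγ : IsGeodesic n γ)
    (h0 : ‖velocity n γ 0‖ ≠ 0) (t τ : ℝ) : ¬ ∀ s, γ (t + s) = γ (τ - s) := by
  intro h
  -- recentre the reflection at its fixed point
  have hsymm : (fun s ↦ γ (1 * s + (t + τ) / 2)) = fun s ↦ γ (-1 * s + (t + τ) / 2) := by
    funext s
    have := h (s + (τ - t) / 2)
    convert this using 2 <;> ring
  have ht : γ ((t + τ) / 2) ∈ (extChartAt (𝓡 n) (γ ((t + τ) / 2))).source :=
    mem_extChartAt_source _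
  have h1 := congrFun (congrArg (fun f ↦ deriv (coordCurve n (γ ((t + τ) / 2)) f)) hsymm) 0
  simp only [coordCurve_affine, mul_zero, zero_add, neg_smul, one_smul] at h1
  refine deriv_coordCurve_ne_zero hγ h0 ht ?_
  have h2 := eq_neg_iff_add_eq_zero.1 h1
  rwa [← two_smul ℝ, smul_eq_zero_iff_right two_ne_zero] at h2

variable [T2Space M]

/-- Geodesics whose velocities are proportional in a chart agree up to an affine change of the
parameter. -/
theorem IsGeodesic.eq_affine {x₀ : M} {γ σ : ℝ → M} {t τ a : ℝ} (hγ : IsGeodesic n γ)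
    (hσ : IsGeodesic n σ) (ht : γ t ∈ (extChartAt (𝓡 n) x₀).source) (h : γ t = σ τ)
    (hd : a • deriv (coordCurve n x₀ γ) t = deriv (coordCurve n x₀ σ) τ) (s : ℝ) :
    γ (a * s + t) = σ (1 * s + τ) := by
  have h1 := hγ.comp_affine a t
  have h2 := hσ.comp_affine 1 τ
  refine congrFun (h1.eq_of_tangentLift_eq (t := 0) h2
    (tangentLift_eq_of_coord (x₀ := x₀) h1.1 h2.1 (by simpa using ht) (by simpa using h) ?_)) s
  rw [coordCurve_affine, coordCurve_affine]
  simpa using hd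

/-- A geodesic with zero velocity at one time is constant. -/
theorem IsGeodesic.norm_velocity_ne_zero {γ : ℝ → M} (hγ : IsGeodesic n γ)
    (h : ∃ s t, γ s ≠ γ t) : ‖velocity n γ 0‖ ≠ 0 := by
  intro h0
  have heq : γ = fun _ ↦ γ 0 := by
    refine hγ.eq_of_tangentLift_eq (isGeodesic_const (γ 0)) (t := 0) ?_
    unfold tangentLift
    rw [velocity_const, norm_eq_zero.1 h0]
  obtain ⟨s, t, hst⟩ := h
  rw [heq] at hst
  exact hst rfl

/-- Two geodesics of the same nonzero speed that meet either coincide there up to the orientation,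
or cross transversally; the crossing times form a countable set. -/
theorem IsGeodesic.countable_crossings {γ σ : ℝ → M} (hγ : IsGeodesic n γ) (hσ : IsGeodesic n σ)
    (h0 : ‖velocity n γ 0‖ ≠ 0) (hv : ‖velocity n σ 0‖ = ‖velocity n γ 0‖) :
    {t | ∃ τ, γ t = σ τ ∧ (¬ ∀ s, γ (t + s) = σ (τ + s)) ∧
      ¬ ∀ s, γ (t + s) = σ (τ - s)}.Countable := by
  -- pairs of crossing times are isolated in the plane
  have hP : {z : ℝ × ℝ | γ z.1 = σ z.2 ∧ (¬ ∀ s, γ (z.1 + s) = σ (z.2 + s)) ∧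
      ¬ ∀ s, γ (z.1 + s) = σ (z.2 - s)}.Countable := by
    refine countable_of_isolated ?_
    rintro ⟨t, τ⟩ ⟨hz, hplus, hminus⟩
    dsimp only at hz hplus hminus
    have ht : γ t ∈ (extChartAt (𝓡 n) (γ t)).source := mem_extChartAt_source _
    have hτ : σ τ ∈ (extChartAt (𝓡 n) (γ t)).source := hz ▸ ht
    have hu := deriv_coordCurve_ne_zero hγ h0 ht
    -- proportional velocities of equal length differ by a sign, and then the germs would agree
    have hind : LinearIndependent ℝ
        ![deriv (coordCurve n (γ t) γ) t, deriv (coordCurve n (γ t) σ) τ] := by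
      refine (LinearIndependent.pair_iff' hu).2 fun a ha ↦ ?_
      have hc : coordCurve n (γ t) σ τ = coordCurve n (γ t) γ t := by simp only [coordCurve, hz]
      have e1 := norm_velocity_sq hγ.1 ht
      have e2 := norm_velocity_sq hσ.1 hτ
      rw [hc, ← ha, coordMetric_smul_left, coordMetric_smul_right, ← e1,
        hγ.norm_velocity_eq t 0, hσ.norm_velocity_eq τ 0, hv] at e2
      have ha2 : a ^ 2 = 1 := by
        have : ‖velocity n γ 0‖ ^ 2 ≠ 0 := pow_ne_zero 2 h0
        apply mul_right_cancel₀ this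
        linarith
      rcases sq_eq_one_iff.1 ha2 with rfl | rfl
      · exact hplus fun s ↦ by
          have := hγ.eq_affine hσ ht hz ha s
          simpa [add_comm] using this
      · exact hminus fun s ↦ by
          have := hγ.eq_affine hσ ht hz ha (-s)
          simpa [add_comm, sub_eq_add_neg] using this
    filter_upwards [eventually_ne_of_linearIndependent hγ.1 hσ.1 ht hτ hind] with z hz' hz''
    exact hz' hz''.1
  refine (hP.image Prod.fst).mono ?_
  rintro t ⟨τ, h⟩
  exact ⟨(t, τ), h, rfl⟩

end Intersections

/-! ### Tuples on periodic curves -/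

section Tuples

variable {M : Type*} {k : ℕ}

theorem tupleClass_eq_of_isRotationOf {γ σ : ℝ → M} (h : IsRotationOf σ γ) :
    tupleClass k γ = tupleClass k σ := by
  obtain ⟨s, hs⟩ := h
  have key : ∀ t, tuple k σ t = tuple k γ (t + s) := fun t ↦ by
    funext i
    simp only [tuple, hs]
    congr 1
    ring
  refine Subset.antisymm ?_ ?_
  · rintro _ ⟨t, rfl⟩
    exact ⟨t - s, by rw [key, sub_add_cancel]⟩
  · rintro _ ⟨t, rfl⟩
    exact ⟨t + s, (key t).symm⟩

/-- The step of the tuples of a curve of period `4π/k` is a half-period, so that reversing the curve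
does not change its tuples. -/
theorem tupleClass_eq_of_isReflectionOf {γ σ : ℝ → M} (hp : Periodic γ (4 * Real.pi / k))
    (h : IsReflectionOf σ γ) : tupleClass k γ = tupleClass k σ := by
  obtain ⟨s, hs⟩ := h
  have key : ∀ t, tuple k σ t = tuple k γ (s - t) := fun t ↦ by
    funext i
    simp only [tuple, hs]
    rw [← hp.nat_mul i]
    congr 1
    ring
  refine Subset.antisymm ?_ ?_
  · rintro _ ⟨t, rfl⟩
    exact ⟨s - t, by rw [key, sub_sub_cancel]⟩
  · rintro _ ⟨t, rfl⟩
    exact ⟨s - t, (key t).symm⟩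

variable [NeZero k]

theorem natCast_ne_zero : (k : ℝ) ≠ 0 := Nat.cast_ne_zero.2 (NeZero.ne k)

/-- The tuples are indexed cyclically because the curve closes up after `k` steps. -/
theorem apply_add_mod {γ : ℝ → M} (h : Periodic γ (2 * Real.pi)) (t : ℝ) (m : ℕ) :
    γ (t + 2 * Real.pi * (m % k : ℕ) / k) = γ (t + 2 * Real.pi * m / k) := by
  have hk := natCast_ne_zero (k := k)
  have hm : (m : ℝ) = k * (m / k : ℕ) + (m % k : ℕ) := by exact_mod_cast (Nat.div_add_mod m k).symm
  rw [← h.nat_mul (m / k) (t + 2 * Real.pi * (m % k : ℕ) / k), hm]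
  congr 1
  field_simp
  ring

theorem val_add_one (i : Fin k) : ((i + 1 : Fin k) : ℕ) = ((i : ℕ) + 1) % k := by
  rw [Fin.val_add, Fin.val_one', Nat.add_mod_mod]

theorem tuple_add_one {γ : ℝ → M} (h : Periodic γ (2 * Real.pi)) (t : ℝ) (i : Fin k) :
    tuple k γ t (i + 1) = γ (t + 2 * Real.pi * (i : ℕ) / k + 2 * Real.pi / k) := by
  unfold tuple
  rw [val_add_one, apply_add_mod h]
  congr 1
  push_cast
  ring

theorem tuple_sub_one {γ : ℝ → M} (h : Periodic γ (2 * Real.pi)) (t : ℝ) (i : Fin k) :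
    tuple k γ t (i - 1) = γ (t + 2 * Real.pi * (i : ℕ) / k - 2 * Real.pi / k) := by
  obtain ⟨j, rfl⟩ : ∃ j, i = j + 1 := ⟨i - 1, by simp⟩
  have h1 := apply_add_mod (k := k) h (t - 2 * Real.pi / k) ((j : ℕ) + 1)
  rw [add_sub_cancel_right, val_add_one, add_sub_right_comm, h1]
  unfold tuple
  congr 1
  push_cast
  ring

theorem tuple_one {γ : ℝ → M} (h : Periodic γ (2 * Real.pi)) (t : ℝ) :
    tuple k γ t (0 + 1) = γ (t + 2 * Real.pi / k) := by
  rw [tuple_add_one h]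
  simp

theorem tuple_zero (γ : ℝ → M) (t : ℝ) : tuple k γ t 0 = γ t := by
  simp [tuple]

/-- Reversing the orientation of a closed curve reverses its tuples. -/
theorem tupleClass_eq_reverseClass {γ σ : ℝ → M} (hp : Periodic γ (2 * Real.pi))
    (h : IsReflectionOf σ γ) : tupleClass k σ = reverseClass (tupleClass k γ) := by
  obtain ⟨s, hs⟩ := h
  have hk := natCast_ne_zero (k := k)
  have key : ∀ t, (fun i ↦ tuple k γ t (Fin.rev i)) = tuple k σ (s - t + 2 * Real.pi / k) := by
    intro t
    funext i
    simp only [tuple, hs]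
    rw [← hp (s - _), Fin.val_rev, Nat.cast_sub i.isLt]
    congr 1
    push_cast
    field_simp
    ring
  refine Subset.antisymm ?_ ?_
  · rintro _ ⟨t, rfl⟩
    refine ⟨_, ⟨s - t + 2 * Real.pi / k, rfl⟩, ?_⟩
    dsimp only
    rw [key]
    congr 1
    ring
  · rintro _ ⟨_, ⟨t, rfl⟩, rfl⟩
    exact ⟨_, (key t).symm⟩

end Tuples

/-! ### Directions of minimizing geodesics -/

section MinDirections

variable {n : ℕ} {M : Type*} [MetricSpace M] [ChartedSpace (EuclideanSpace ℝ (Fin n)) M]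

theorem tangentLift_comp_affine {γ : ℝ → M} (hγ : ContMDiff 𝓘(ℝ, ℝ) (𝓡 n) ∞ γ) (a t : ℝ) :
    tangentLift n (fun s ↦ γ (a * s + t)) 0 = ⟨γ t, a • velocity n γ t⟩ := by
  have h : tangentLift n (fun s ↦ γ (a * s + t)) 0 =
      ⟨γ (a * 0 + t), a • velocity n γ (a * 0 + t)⟩ := by
    unfold tangentLift
    rw [velocity_comp_affine hγ]
  have h2 : a * 0 + t = t := by ring
  exact h.trans (congrArg (fun r ↦ (⟨γ r, a • velocity n γ r⟩ : TangentBundle (𝓡 n) M)) h2)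

variable [RiemannianBundle (fun x : M ↦ TangentSpace (𝓡 n) x)]
variable [IsManifold (𝓡 n) ∞ M] [IsContMDiffRiemannianBundle (𝓡 n) ∞ (EuclideanSpace ℝ (Fin n))
      (fun x : M ↦ TangentSpace (𝓡 n) x)]

/-- A unit multiple of the velocity of a geodesic points along a minimizing geodesic to `p` exactly
if the geodesic itself, run with that velocity, reaches `p` after the time `d(γ(t), p)`. -/
theorem IsGeodesic.smul_velocity_mem_minDirections_iff {γ : ℝ → M} (hγ : IsGeodesic n γ)
    {a t : ℝ} {p : M} (ha : ‖a • velocity n γ t‖ = 1) :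
    a • velocity n γ t ∈ minDirections n (γ t) p ↔ γ (a * dist (γ t) p + t) = p := by
  have hσ := hγ.comp_affine a t
  have hlift := tangentLift_comp_affine hγ.1 a t
  constructor
  · rintro ⟨σ, hσ', hp, hl⟩
    have := hσ'.1.eq_of_tangentLift_eq hσ (t := 0) (hl.trans hlift.symm)
    rw [this] at hp
    exact hp
  · intro h
    refine ⟨fun s ↦ γ (a * s + t), ⟨hσ, fun s ↦ ?_⟩, h, hlift⟩
    rw [hσ.norm_velocity_eq s 0, ← ha]
    exact congrArg (fun p : TangentBundle (𝓡 n) M ↦ ‖p.2‖) hlift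

theorem IsGeodesic.direction_eq {γ : ℝ → M} (hγ : IsGeodesic n γ) (t : ℝ) :
    direction n γ t = ‖velocity n γ 0‖⁻¹ • velocity n γ t := by
  rw [direction, hγ.norm_velocity_eq t 0]

theorem IsGeodesic.direction_mem_minDirections_iff {γ : ℝ → M} (hγ : IsGeodesic n γ)
    (h0 : ‖velocity n γ 0‖ ≠ 0) {t : ℝ} {p : M} :
    direction n γ t ∈ minDirections n (γ t) p ↔ γ (t + dist (γ t) p / ‖velocity n γ 0‖) = p := by
  rw [hγ.direction_eq, hγ.smul_velocity_mem_minDirections_iff, add_comm, div_eq_inv_mul]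
  rw [norm_smul, norm_inv, norm_norm, hγ.norm_velocity_eq t 0, inv_mul_cancel₀ h0]

theorem IsGeodesic.neg_direction_mem_minDirections_iff {γ : ℝ → M} (hγ : IsGeodesic n γ)
    (h0 : ‖velocity n γ 0‖ ≠ 0) {t : ℝ} {p : M} :
    -direction n γ t ∈ minDirections n (γ t) p ↔ γ (t - dist (γ t) p / ‖velocity n γ 0‖) = p := by
  rw [hγ.direction_eq, ← neg_smul, hγ.smul_velocity_mem_minDirections_iff, neg_mul,
    neg_add_eq_sub, div_eq_inv_mul]
  rw [norm_smul, norm_neg, norm_inv, norm_norm, hγ.norm_velocity_eq t 0, inv_mul_cancel₀ h0]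

end MinDirections

/-! ### `1/k`-geodesics and classes of balanced points -/

section OneDiv

variable {n : ℕ} {M : Type*} [MetricSpace M] [ChartedSpace (EuclideanSpace ℝ (Fin n)) M]
  [RiemannianBundle (fun x : M ↦ TangentSpace (𝓡 n) x)]

theorem IsGeodesic.comp_mul {γ : ℝ → M} (h : IsGeodesic n γ) (a : ℝ) :
    IsGeodesic n fun t ↦ γ (a * t) := by
  simpa only [add_zero] using h.comp_affine a 0

theorem norm_velocity_comp_mul {γ : ℝ → M} (h : ContMDiff 𝓘(ℝ, ℝ) (𝓡 n) ∞ γ) (a : ℝ) :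
    ‖velocity n (fun t ↦ γ (a * t)) 0‖ = |a| * ‖velocity n γ 0‖ := by
  have h1 := tangentLift_comp_affine h a 0
  simp only [add_zero] at h1
  have h2 : ‖velocity n (fun t ↦ γ (a * t)) 0‖ = ‖a • velocity n γ 0‖ :=
    congrArg (fun p : TangentBundle (𝓡 n) M ↦ ‖p.2‖) h1
  rw [h2, norm_smul, Real.norm_eq_abs]

variable [IsManifold (𝓡 n) ∞ M] [IsContMDiffRiemannianBundle (𝓡 n) ∞ (EuclideanSpace ℝ (Fin n))
      (fun x : M ↦ TangentSpace (𝓡 n) x)] {k : ℕ}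

theorem IsClosedGeodesic.norm_velocity_pos {γ : ℝ → M} (h : IsClosedGeodesic n γ) :
    0 < ‖velocity n γ 0‖ :=
  lt_of_le_of_ne (norm_nonneg _) (h.1.norm_velocity_ne_zero h.2.2).symm

theorem IsOneDivGeodesic.dist_eq {γ : ℝ → M} (h : IsOneDivGeodesic n k γ) (t : ℝ) :
    dist (γ t) (γ (t + 2 * Real.pi / k)) = 2 * Real.pi / k * ‖velocity n γ 0‖ := by
  rw [h.2 t, h.1.1.circleLength_eq]
  ring

/-- Reversals of `1/k`-geodesics are `1/k`-geodesics. The corresponding fact for strict ones would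
need the symmetry of the cut point relation. -/
theorem IsOneDivGeodesic.comp_neg {γ : ℝ → M} (h : IsOneDivGeodesic n k γ) :
    IsOneDivGeodesic n k fun t ↦ γ (-t) := by
  have hg : IsGeodesic n fun t ↦ γ (-t) := by simpa only [neg_one_mul] using h.1.1.comp_mul (-1)
  have hv : ‖velocity n (fun t ↦ γ (-t)) 0‖ = ‖velocity n γ 0‖ := by
    have h1 : (fun t ↦ γ (-t)) = fun t ↦ γ (-1 * t) := by simp only [neg_one_mul]
    refine (congrArg (fun f ↦ ‖velocity n f 0‖) h1).trans ?_
    rw [norm_velocity_comp_mul h.1.1.1, abs_neg, abs_one, one_mul]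
  obtain ⟨s, t, hst⟩ := h.1.2.2
  refine ⟨⟨hg, fun u ↦ ?_, -s, -t, by simpa using hst⟩, fun u ↦ ?_⟩
  · dsimp only
    rw [← h.1.2.1 (-(u + 2 * Real.pi))]
    congr 1
    ring
  · have h1 := h.dist_eq (-(u + 2 * Real.pi / k))
    rw [neg_add, neg_add_cancel_right, dist_comm] at h1
    rw [hg.circleLength_eq, hv]
    dsimp only
    rw [neg_add, h1]
    ring

variable [NeZero k]

theorem step_pos : 0 < 2 * Real.pi / k :=
  div_pos Real.two_pi_pos (Nat.cast_pos.2 (NeZero.pos k))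

theorem mul_step : (k : ℝ) * (2 * Real.pi / k) = 2 * Real.pi :=
  mul_div_cancel₀ _ natCast_ne_zero

/-- A `1/k`-geodesic is minimizing between consecutive points of its tuples, in both directions. -/
theorem IsOneDivGeodesic.direction_mem {γ : ℝ → M} (h : IsOneDivGeodesic n k γ) (t : ℝ)
    (i : Fin k) :
    direction n γ (t + 2 * Real.pi * (i : ℕ) / k) ∈
      minDirections n (γ (t + 2 * Real.pi * (i : ℕ) / k)) (tuple k γ t (i + 1)) ∧
    -direction n γ (t + 2 * Real.pi * (i : ℕ) / k) ∈
      minDirections n (γ (t + 2 * Real.pi * (i : ℕ) / k)) (tuple k γ t (i - 1)) := by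
  have h0 := h.1.norm_velocity_pos.ne'
  rw [h.1.1.direction_mem_minDirections_iff h0, h.1.1.neg_direction_mem_minDirections_iff h0,
    tuple_add_one h.1.2.1, tuple_sub_one h.1.2.1, h.dist_eq, dist_comm]
  have h1 := h.dist_eq (t + 2 * Real.pi * (i : ℕ) / k - 2 * Real.pi / k)
  rw [sub_add_cancel] at h1
  rw [h1, mul_div_cancel_right₀ _ h0]
  exact ⟨rfl, rfl⟩

theorem IsOneDivGeodesic.isBalanced {γ : ℝ → M} (h : IsOneDivGeodesic n k γ) (t : ℝ) :
    IsBalanced n (tuple k γ t) := by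
  refine ⟨fun i ↦ ?_, _, h.direction_mem t⟩
  rw [tuple_add_one h.1.2.1, tuple_sub_one h.1.2.1]
  have h1 := h.dist_eq (t + 2 * Real.pi * (i : ℕ) / k - 2 * Real.pi / k)
  rw [sub_add_cancel, ← h.dist_eq (t + 2 * Real.pi * (i : ℕ) / k)] at h1
  exact h1

theorem IsOneDivGeodesic.isAssociated {γ : ℝ → M} (h : IsOneDivGeodesic n k γ) (t : ℝ) :
    IsAssociated n γ (tuple k γ t) :=
  ⟨h.1, t, rfl, h.direction_mem t⟩

theorem IsOneDivGeodesic.isRotatingVia {γ : ℝ → M} (h : IsOneDivGeodesic n k γ) (t : ℝ) :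
    IsRotatingVia n γ (tuple k γ t) :=
  ⟨h.isBalanced t, h.isAssociated t, fun s ↦ ⟨h.isBalanced s, h.isAssociated s⟩⟩

theorem IsOneDivGeodesic.uniformEnergy_ne_zero {γ : ℝ → M} (h : IsOneDivGeodesic n k γ) (t : ℝ) :
    uniformEnergy (tuple k γ t) ≠ 0 := by
  refine (Finset.sum_pos (fun i _ ↦ ?_) Finset.univ_nonempty).ne'
  have hd : 0 < dist (tuple k γ t i) (tuple k γ t (i + 1)) := by
    rw [tuple_add_one h.1.2.1]
    unfold tuple
    rw [h.dist_eq]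
    exact mul_pos step_pos h.1.norm_velocity_pos
  have hk : (0 : ℝ) < k := Nat.cast_pos.2 (NeZero.pos k)
  positivity

theorem IsStrictOneDivGeodesic.isNonsmoothClass {γ : ℝ → M} (h : IsStrictOneDivGeodesic n k γ) :
    IsNonsmoothClass n (tupleClass k γ) := by
  obtain ⟨h, t, hcut⟩ := h
  refine ⟨⟨γ, tuple k γ 0, h.isRotatingVia 0, rfl⟩, ⟨_, ⟨t, rfl⟩, h.isBalanced t, 0, ?_⟩, ?_⟩
  · rwa [tuple_one h.1.2.1, tuple_zero]
  · rintro _ ⟨s, rfl⟩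
    exact h.uniformEnergy_ne_zero s

/-- If every tuple of the closed geodesic `γ` is balanced with associated geodesic `γ`, then along
`γ` the distance `d(γ(t), γ(t + 2π/k))` is the distance covered in a fixed time `a`, and `γ`
takes the same values at the times `t + a` and `t + 2π/k`. -/
theorem exists_step_of_isAssociated {γ : ℝ → M} (hγ : IsClosedGeodesic n γ)
    (h : ∀ t, IsAssociated n γ (tuple k γ t)) :
    ∃ a, ∀ t, γ (t + a) = γ (t + 2 * Real.pi / k) ∧
      dist (γ t) (γ (t + 2 * Real.pi / k)) = a * ‖velocity n γ 0‖ := by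
  have h0 := hγ.norm_velocity_pos.ne'
  set v := ‖velocity n γ 0‖
  set δ := 2 * Real.pi / k
  have hcont : Continuous γ := hγ.1.1.continuous
  set D : ℝ → ℝ := fun t ↦ dist (γ t) (γ (t + δ)) with hD
  have hDc : Continuous D := hcont.dist (hcont.comp (continuous_add_const δ))
  have hZ := hγ.1.countable_crossings hγ.1 h0 rfl
  set Z := {t | ∃ τ, γ t = γ τ ∧ (¬ ∀ s, γ (t + s) = γ (τ + s)) ∧ ¬ ∀ s, γ (t + s) = γ (τ - s)}
  have hcase : ∀ t τ, t ∉ Z → γ t = γ τ → ∀ s, γ (t + s) = γ (τ + s) := by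
    intro t τ ht hτ
    by_contra hne
    exact ht ⟨τ, hτ, hne, hγ.1.not_reflection h0 t τ⟩
  -- away from the self-crossings, `γ` has the same germ at the two times of the association
  have hstep : (fun t ↦ γ (t + D t / v)) = fun t ↦ γ (t + δ) := by
    refine Continuous.ext_on (hZ.dense_compl ℝ)
      (hcont.comp (continuous_id.add (hDc.div_const v)))
      (hcont.comp (continuous_add_const δ)) fun t ht ↦ ?_
    obtain ⟨-, τ, hτ, hdir⟩ := h t
    have h1 := (hγ.1.direction_mem_minDirections_iff h0).1 (hdir 0).1
    have e0 : γ t = γ τ := by rw [← tuple_zero (k := k) γ t, hτ, tuple_zero]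
    rw [tuple_one hγ.2.1] at h1
    simp only [Fin.val_zero, Nat.cast_zero, mul_zero, zero_div, add_zero, ← e0] at h1
    rw [hcase t τ ht e0]
    exact h1
  -- the distance is constant, as it is continuous and takes countably many values
  have hcount : (range D).Countable := by
    have hR := hγ.1.countable_fiber h0 (γ 0)
    refine ((hR.image fun r ↦ (r + δ) * v).union
      ((hZ.image fun z ↦ z - δ).image D)).mono ?_
    rintro _ ⟨t, rfl⟩
    by_cases ht : t + δ ∈ Z
    · exact Or.inr ⟨t, ⟨t + δ, ht, add_sub_cancel_right t δ⟩, rfl⟩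
    · refine Or.inl ⟨D t / v - δ, ?_, ?_⟩
      · have h1 := hcase (t + δ) (t + D t / v) ht (congrFun hstep t).symm (-(t + δ))
        rw [add_neg_cancel] at h1
        rw [mem_ofPred_eq, h1]
        congr 1
        ring
      · dsimp only
        rw [sub_add_cancel, div_mul_cancel₀ _ h0]
  have hconst : ∀ s t, D s = D t := fun s t ↦
    hcount.isTotallyDisconnected _ subset_rfl (isPreconnected_range hDc) ⟨s, rfl⟩ ⟨t, rfl⟩
  refine ⟨D 0 / v, fun t ↦ ⟨?_, ?_⟩⟩
  · rw [hconst 0 t]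
    exact congrFun hstep t
  · rw [div_mul_cancel₀ _ h0, hconst 0 t]

/-- The geodesic by means of which a class rotates need not be a `1/k`-geodesic: if, for
instance, it covers a `1/k`-geodesic `m` times, with `m ≡ 1` modulo `k`, the two have the same
tuples. Reparametrized so that the step of the tuples takes the time `2π/k`, it is one, with the
same tuples. -/
theorem exists_isOneDivGeodesic {γ : ℝ → M} (hγ : IsClosedGeodesic n γ)
    (h : ∀ t, IsAssociated n γ (tuple k γ t)) (hE : uniformEnergy (tuple k γ 0) ≠ 0) :
    ∃ (σ : ℝ → M) (c : ℝ), IsOneDivGeodesic n k σ ∧ c ≠ 0 ∧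
      ∀ t, tuple k σ t = tuple k γ (c * t) := by
  obtain ⟨a, ha⟩ := exists_step_of_isAssociated hγ h
  have hv := hγ.norm_velocity_pos
  have hδ : 0 < 2 * Real.pi / k := step_pos
  have hk : (k : ℝ) ≠ 0 := natCast_ne_zero
  have ha0 : a ≠ 0 := by
    rintro rfl
    refine hE (Finset.sum_eq_zero fun i _ ↦ ?_)
    rw [tuple_add_one hγ.2.1]
    unfold tuple
    rw [(ha _).2]
    simp
  have ha1 : 0 < a := by
    have h1 : 0 ≤ a * ‖velocity n γ 0‖ := (ha 0).2 ▸ dist_nonneg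
    exact lt_of_le_of_ne (nonneg_of_mul_nonneg_left h1 hv) ha0.symm
  -- iterating, `m` steps of length `a` lead to the same point as `m` steps of length `2π/k`
  have hmul : ∀ (m : ℕ) (t : ℝ), γ (t + m * a) = γ (t + m * (2 * Real.pi / k)) := by
    intro m
    induction m with
    | zero => simp
    | succ m ih =>
      intro t
      have h1 := ih (t + a)
      have h2 := (ha (t + m * (2 * Real.pi / k))).1
      push_cast
      rw [show t + (m + 1) * a = t + a + m * a by ring, h1,
        show t + a + m * (2 * Real.pi / k) = t + m * (2 * Real.pi / k) + a by ring, h2]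
      congr 1
      ring
  set c := a / (2 * Real.pi / k) with hc
  have hc0 : 0 < c := div_pos ha1 hδ
  have hcδ : c * (2 * Real.pi / k) = a := div_mul_cancel₀ _ hδ.ne'
  have hσ : IsGeodesic n fun s ↦ γ (c * s) := hγ.1.comp_mul c
  refine ⟨fun s ↦ γ (c * s), c, ⟨⟨hσ, fun s ↦ ?_, ?_⟩, fun s ↦ ?_⟩, hc0.ne', fun t ↦ ?_⟩
  · dsimp only
    rw [← mul_step (k := k), mul_add, mul_left_comm, hcδ, hmul, mul_step, hγ.2.1]
  · obtain ⟨s, t, hst⟩ := hγ.2.2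
    refine ⟨s / c, t / c, ?_⟩
    dsimp only
    rwa [mul_div_cancel₀ _ hc0.ne', mul_div_cancel₀ _ hc0.ne']
  · rw [hσ.circleLength_eq, norm_velocity_comp_mul hγ.1.1, abs_of_pos hc0]
    dsimp only
    rw [mul_add, hcδ, (ha _).1, (ha _).2, ← hcδ]
    ring
  · funext i
    have h1 := hmul i (c * t)
    dsimp only [tuple]
    rw [show c * (t + 2 * Real.pi * (i : ℕ) / k) = c * t + i * a by rw [← hcδ]; ring, h1]
    congr 1
    ring

theorem exists_isStrictOneDivGeodesic {C : Set (Fin k → M)} (hC : IsNonsmoothClass n C) :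
    ∃ γ : ℝ → M, IsStrictOneDivGeodesic n k γ ∧ tupleClass k γ = C := by
  obtain ⟨⟨γ, x, ⟨-, hx, hrot⟩, rfl⟩, ⟨_, ⟨t, rfl⟩, -, i, hcut⟩, hE⟩ := hC
  obtain ⟨σ, c, hσ, hc, htup⟩ :=
    exists_isOneDivGeodesic hx.1 (fun t ↦ (hrot t).2) (hE _ ⟨0, rfl⟩)
  have ht : tuple k γ t = tuple k σ (t / c) := by rw [htup, mul_div_cancel₀ _ hc]
  refine ⟨σ, ⟨hσ, t / c + 2 * Real.pi * (i : ℕ) / k, ?_⟩, Subset.antisymm ?_ ?_⟩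
  · rw [ht, tuple_add_one hσ.1.2.1] at hcut
    exact hcut
  · rintro _ ⟨s, rfl⟩
    exact ⟨c * s, (htup s).symm⟩
  · rintro _ ⟨s, rfl⟩
    exact ⟨s / c, by rw [htup, mul_div_cancel₀ _ hc]⟩

/-- For odd `k`, the number `2π/k` is a combination of the periods `4π/k` and `2π`, but the step of
the tuples of a `1/k`-geodesic moves every point. -/
theorem IsOneDivGeodesic.even_of_periodic {γ : ℝ → M} (h : IsOneDivGeodesic n k γ)
    (hp : Periodic γ (4 * Real.pi / k)) : Even k := by
  by_contra hodd
  obtain ⟨m, hm⟩ := Nat.not_even_iff_odd.1 hodd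
  have hk : (k : ℝ) ≠ 0 := natCast_ne_zero
  have hm' : (k : ℝ) = 2 * m + 1 := by exact_mod_cast hm
  have h1 := hp.nat_mul m (0 + 2 * Real.pi / k)
  have h2 : (0 : ℝ) + 2 * Real.pi / k + m * (4 * Real.pi / k) = 0 + 2 * Real.pi := by
    field_simp
    rw [hm']
    ring
  rw [h2, h.1.2.1] at h1
  have h3 := h.dist_eq 0
  rw [← h1, dist_self] at h3
  exact (mul_pos (step_pos (k := k)) h.1.norm_velocity_pos).ne h3

/-- The tuples of a `1/k`-geodesic determine it up to the base point, and up to the orientation if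
`4π/k` is a period. Off a countable set of times, a common tuple is a common germ of the two
geodesics up to the orientation, and one common germ determines the geodesic. Strictness plays no
role here. -/
theorem IsOneDivGeodesic.isRotationOf_or_isReflectionOf {γ σ : ℝ → M}
    (hγ : IsOneDivGeodesic n k γ) (hσ : IsOneDivGeodesic n k σ)
    (h : tupleClass k γ = tupleClass k σ) :
    IsRotationOf σ γ ∨ (Even k ∧ Periodic γ (4 * Real.pi / k) ∧ IsReflectionOf σ γ) := by
  have hdata : ∀ t, ∃ τ, σ t = γ τ ∧ σ (t + 2 * Real.pi / k) = γ (τ + 2 * Real.pi / k) := by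
    intro t
    obtain ⟨τ, hτ⟩ : tuple k σ t ∈ tupleClass k γ := h ▸ mem_range_self t
    refine ⟨τ, ?_, ?_⟩
    · rw [← tuple_zero (k := k) γ, hτ, tuple_zero]
    · rw [← tuple_one hγ.1.2.1, hτ, tuple_one hσ.1.2.1]
  have hv : ‖velocity n γ 0‖ = ‖velocity n σ 0‖ := by
    obtain ⟨τ, h1, h2⟩ := hdata 0
    have h3 : dist (σ 0) (σ (0 + 2 * Real.pi / k)) = dist (γ τ) (γ (τ + 2 * Real.pi / k)) := by
      rw [h1, h2]
    rw [hσ.dist_eq, hγ.dist_eq] at h3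
    exact mul_left_cancel₀ (step_pos (k := k)).ne' h3.symm
  have hZ := hσ.1.1.countable_crossings hγ.1.1 hσ.1.norm_velocity_pos.ne' hv
  set Z := {t | ∃ τ, σ t = γ τ ∧ (¬ ∀ s, σ (t + s) = γ (τ + s)) ∧ ¬ ∀ s, σ (t + s) = γ (τ - s)}
  by_cases hrot : ∃ t τ, ∀ s, σ (t + s) = γ (τ + s)
  · obtain ⟨t, τ, hs⟩ := hrot
    refine Or.inl ⟨τ - t, fun u ↦ ?_⟩
    rw [← add_sub_cancel t u, hs]
    congr 1
    ring
  push Not at hrot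
  have href : ∀ t, t ∉ Z → ∃ τ, σ (t + 2 * Real.pi / k) = γ (τ + 2 * Real.pi / k) ∧
      ∀ s, σ (t + s) = γ (τ - s) := by
    intro t ht
    obtain ⟨τ, h1, h2⟩ := hdata t
    refine ⟨τ, h2, ?_⟩
    by_contra hne
    exact ht ⟨τ, h1, fun hall ↦ (hrot t τ).elim fun s hs ↦ hs (hall s), hne⟩
  have hdense := hZ.dense_compl ℝ
  obtain ⟨t₀, ht₀⟩ := hdense.nonempty
  obtain ⟨τ₀, -, hs₀⟩ := href t₀ ht₀
  have hrefl : ∀ u, σ u = γ (t₀ + τ₀ - u) := fun u ↦ by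
    rw [← add_sub_cancel t₀ u, hs₀]
    congr 1
    ring
  have hcont : Continuous σ := hσ.1.1.1.continuous
  -- both neighbours of `σ t` in its tuples are `γ (τ + 2π/k)`
  have heq : (fun t ↦ σ (t - 2 * Real.pi / k)) = fun t ↦ σ (t + 2 * Real.pi / k) := by
    refine Continuous.ext_on hdense (hcont.comp (continuous_sub_right _))
      (hcont.comp (continuous_add_const _)) fun t ht ↦ ?_
    obtain ⟨τ, h1, h2⟩ := href t ht
    rw [h1, sub_eq_add_neg, h2, sub_neg_eq_add]
  have hp : Periodic γ (4 * Real.pi / k) := by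
    intro u
    have h1 := congrFun heq (t₀ + τ₀ - u - 2 * Real.pi / k)
    rw [hrefl, hrefl] at h1
    convert h1 using 2 <;> ring
  exact Or.inr ⟨hγ.even_of_periodic hp, hp, t₀ + τ₀, hrefl⟩

end OneDiv

end UniformEnergy

end

theorem mainTheorem6 (n : ℕ) {M : Type*} [MetricSpace M] [CompactSpace M]
    [ChartedSpace (EuclideanSpace ℝ (Fin n)) M] [IsManifold (𝓡 n) ∞ M]
    [RiemannianBundle (fun x : M ↦ TangentSpace (𝓡 n) x)]
    [IsContMDiffRiemannianBundle (𝓡 n) ∞ (EuclideanSpace ℝ (Fin n))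
      (fun x : M ↦ TangentSpace (𝓡 n) x)]
    [IsRiemannianManifold (𝓡 n) M] (k : ℕ) [NeZero k] :
    -- a strict `1/k`-geodesic generates a non-smooth class of nonzero energy associated to it
    (∀ γ : ℝ → M, UniformEnergy.IsStrictOneDivGeodesic n k γ →
      UniformEnergy.IsNonsmoothClass n (UniformEnergy.tupleClass k γ) ∧
      ∀ x ∈ UniformEnergy.tupleClass k γ, UniformEnergy.IsRotatingVia n γ x) ∧
    -- every non-smooth class of nonzero energy arises in this way
    (∀ C : Set (Fin k → M), UniformEnergy.IsNonsmoothClass n C →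
      ∃ γ : ℝ → M, UniformEnergy.IsStrictOneDivGeodesic n k γ ∧
        UniformEnergy.tupleClass k γ = C) ∧
    -- the class determines the oriented geodesic up to the base point, except that it does not
    -- see the orientation of a geodesic with period `4π/k`
    (∀ γ σ : ℝ → M, UniformEnergy.IsStrictOneDivGeodesic n k γ →
      UniformEnergy.IsStrictOneDivGeodesic n k σ →
      (UniformEnergy.tupleClass k γ = UniformEnergy.tupleClass k σ ↔
        UniformEnergy.IsRotationOf σ γ ∨
          (Even k ∧ Periodic γ (4 * Real.pi / k) ∧ UniformEnergy.IsReflectionOf σ γ))) ∧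
    -- the resulting correspondence of unoriented geodesics and unoriented classes is bijective
    (∃ Φ : Quotient (UniformEnergy.strictSetoid M n k) →
        Quotient (UniformEnergy.classSetoid M n k),
      (∀ (γ : {γ : ℝ → M // UniformEnergy.IsStrictOneDivGeodesic n k γ})
          (C : {C : Set (Fin k → M) // UniformEnergy.IsNonsmoothClass n C}),
        C.1 = UniformEnergy.tupleClass k γ.1 →
          Φ (Quotient.mk (UniformEnergy.strictSetoid M n k) γ) =
            Quotient.mk (UniformEnergy.classSetoid M n k) C) ∧
      Bijective Φ) := by
  refine ⟨fun γ hγ ↦ ⟨hγ.isNonsmoothClass, ?_⟩, fun C hC ↦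
    UniformEnergy.exists_isStrictOneDivGeodesic hC, fun γ σ hγ hσ ↦ ⟨fun h ↦
      hγ.1.isRotationOf_or_isReflectionOf hσ.1 h, ?_⟩, ?_⟩
  · rintro _ ⟨t, rfl⟩
    exact hγ.1.isRotatingVia t
  · rintro (h | ⟨-, hp, h⟩)
    · exact UniformEnergy.tupleClass_eq_of_isRotationOf h
    · exact UniformEnergy.tupleClass_eq_of_isReflectionOf hp h
  · refine ⟨Quotient.map' (s₁ := UniformEnergy.strictSetoid M n k)
      (s₂ := UniformEnergy.classSetoid M n k)
      (fun γ ↦ ⟨UniformEnergy.tupleClass k γ.1, γ.2.isNonsmoothClass⟩) ?_, ?_, ?_, ?_⟩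
    · rintro ⟨γ, hγ⟩ ⟨σ, hσ⟩ (h | h)
      · exact Or.inl (UniformEnergy.tupleClass_eq_of_isRotationOf h).symm
      · exact Or.inr (UniformEnergy.tupleClass_eq_reverseClass hγ.1.1.2.1 h)
    · rintro γ ⟨C, hC⟩ rfl
      rfl
    · rintro ⟨γ, hγ⟩ ⟨σ, hσ⟩ h
      refine Quotient.sound (s := UniformEnergy.strictSetoid M n k) ?_
      rcases Quotient.exact (s := UniformEnergy.classSetoid M n k) h with h | h
      · rcases hγ.1.isRotationOf_or_isReflectionOf hσ.1 h.symm with h | ⟨-, -, h⟩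
        · exact Or.inl h
        · exact Or.inr h
      · -- the reversal of `γ` need not be known to be strict for the comparison with `σ`
        rw [← UniformEnergy.tupleClass_eq_reverseClass (σ := fun t ↦ γ (-t)) hγ.1.1.2.1
          ⟨0, fun t ↦ by rw [zero_sub]⟩] at h
        rcases hγ.1.comp_neg.isRotationOf_or_isReflectionOf hσ.1 h.symm with
          ⟨s, hs⟩ | ⟨-, -, s, hs⟩
        · exact Or.inr ⟨-s, fun t ↦ (hs t).trans (congrArg γ (by ring))⟩
        · exact Or.inl ⟨-s, fun t ↦ (hs t).trans (congrArg γ (by ring))⟩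
    · rintro ⟨C, hC⟩
      obtain ⟨γ, hγ, rfl⟩ := UniformEnergy.exists_isStrictOneDivGeodesic hC
      exact ⟨Quotient.mk _ ⟨γ, hγ⟩, rfl⟩
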